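/- Let $f:\mathbb R^n\to\mathbb R$ be convex and continuously differentiable with $L$-Lipschitz gradient in the sense that $f(y)\le f(x)+\langle\nabla f(x),y-x\rangle+\frac L2\|x-y\|_2^2$ for all $x,y$, let $x^*$ be a minimizer of $f$, and let $R\ge\|x^0-x^*\|_2$. Let $\nabla f(x,\xi)$ be a stochastic gradient with $\mathbb E\nabla f(x,\xi)=\nabla f(x)$ and $\mathbb E\exp\left(\|\nabla f(x,\xi)-\nabla f(x)\|_2^2/\sigma^2\right)\le e$ for all $x$, where $\sigma>0$, and let $\sigma_0\ge\sigma$. Let $0<\underline L\le L\le\bar L$ be such that $m=\log_2(\bar L/\underline L)$ is a positive integer, and let $\underline L\le L_0\le\bar L$, $\varepsilon>0$, $\alpha\in(0,1)$, $N\ge2$. Put $$\Lambda=\ln\alpha^{-1}+m\ln N,\qquad B(\ell)=\frac{\sigma_0^2\bar L^2}{\ell\,\varepsilon\,\underline L^2}\,\Lambda .$$ The adaptive stochastic gradient method with batch constant $\kappa>0$ starts from $(x^0,L_0)$ and does the following for $k=0,\dots,N-1$. It draws $r_{k+1}=\max\{\lceil\kappa B(L_k)\rceil,1\}$ fresh independent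 samples $\xi^{k+1}_l$ of $\xi$ and computes $g^{k+1}=\frac1{r_{k+1}}\sum_{l=1}^{r_{k+1}}\nabla f(x^k,\xi_l^{k+1})$. It sets $L_{k+1}:=\max\{L_k/2,\underline L\}$ and then repeats $$L_{k+1}:=\min\{2L_{k+1},\bar L\},\qquad x^{k+1}:=x^k-\tfrac1{2L_{k+1}}g^{k+1}$$ until $$f(x^{k+1})\le f(x^k)+\langle g^{k+1},x^{k+1}-x^k\rangle+L_{k+1}\|x^{k+1}-x^k\|_2^2+\varepsilon/2 .$$ Its output, if all $N$ of these loops terminate, is $$\bar x^N=\Big(\sum_{k=0}^{N-1}\tfrac1{L_{k+1}}\Big)^{-1}\sum_{k=0}^{N-1}\tfrac1{L_{k+1}}x^{k+1}.$$ Let $T$ be the number of stochastic gradients computed, that is, the sum of the batch sizes over all iterations that are reached. There is a universal constant $c_0>0$ such that for every $c_1\ge c_0$ there is $\kappa_0>0$, depending only on $c_1$, such that for every $\kappa\ge\kappa_0$ there is $K>0$, depending only on $c_1$ and $\kappa$, for which the following holds for all data as above (in any dimension $n$) with $$c_0\,\frac{\bar LR^2}{\varepsilon}\le N\le c_1\,\frac{\bar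 LR^2}{\varepsilon}.$$ 1. The number of oracle calls always satisfies $$T\le N+K\Lambda\,\frac{\sigma_0^2R^2\bar L^3}{\varepsilon^2\underline L^3},$$ and if $\kappa B(\bar L)\ge1$ (so that $\kappa B(L_k)\ge 1$ in every iteration), it always satisfies $$T\le K\Lambda\,\frac{\sigma_0^2R^2\bar L^3}{\varepsilon^2\underline L^3}.$$ 2. With probability at least $1-\alpha$, all $N$ loops terminate and $f(\bar x^N)-f(x^*)\le\varepsilon$. -/

import Mathlib

open MeasureTheory ProbabilityTheory Set
open scoped Gradient

noncomputable section

/-- The input of the adaptive stochastic gradient method: the objective `f`, the stochastic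
gradient `G x s = ∇f(x, s)`, the accuracy `ε`, the bound `σ₀` on the noise level, the confidence
parameter `α`, the lower and upper estimates `Llo ≤ Lhi` of the Lipschitz constant, the initial
guess `L₀`, the starting point `x₀`, the number of iterations `N`, and the constant `κ` in the
batch size. -/
structure AdaptiveSGD (E S : Type*) where
  f : E → ℝ
  G : E → S → E
  ε : ℝ
  σ₀ : ℝ
  α : ℝ
  Llo : ℝ
  Lhi : ℝ
  L₀ : ℝ
  x₀ : E
  N : ℕ
  κ : ℝ

namespace AdaptiveSGD

/-- The current point `x^k` together with the current estimate `L_k`. -/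
structure State (E : Type*) where
  x : E
  L : ℝ

variable {E S : Type*} [NormedAddCommGroup E] [InnerProductSpace ℝ E]

/-- `ln α⁻¹ + m ln N`, where `m = log₂ (Lhi / Llo)`. -/
def logFactor (A : AdaptiveSGD E S) : ℝ :=
  Real.log A.α⁻¹ + Real.logb 2 (A.Lhi / A.Llo) * Real.log A.N

/-- The quantity `σ₀² Lhi² (ln α⁻¹ + m ln N) / (L ε Llo²)`. -/
def batchScale (A : AdaptiveSGD E S) (L : ℝ) : ℝ :=
  A.σ₀ ^ 2 * A.Lhi ^ 2 / (L * A.ε * A.Llo ^ 2) * A.logFactor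

/-- The batch size `r_{k+1}` as a function of `L = L_k`. -/
def batchSize (A : AdaptiveSGD E S) (L : ℝ) : ℕ :=
  max ⌈A.κ * A.batchScale L⌉₊ 1

/-- The mini-batch gradient `(1/r) ∑_{l < r} ∇f(x, s_l)`. -/
def miniBatch (A : AdaptiveSGD E S) (x : E) (r : ℕ) (s : ℕ → S) : E :=
  (1 / (r : ℝ)) • ∑ l ∈ Finset.range r, A.G x (s l)

/-- The gradient step from `x` along `g` with step size `1 / (2 L)`. -/
def gradStep (x g : E) (L : ℝ) : E := x - (1 / (2 * L)) • g

/-- The stopping criterion of the backtracking loop, for the trial value `L`. -/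
def Accepts (A : AdaptiveSGD E S) (x g : E) (L : ℝ) : Prop :=
  A.f (gradStep x g L) ≤
    A.f x + inner ℝ g (gradStep x g L - x) + L * ‖gradStep x g L - x‖ ^ 2 + A.ε / 2

/-- The value of the estimate in the `i`-th pass (`i = 0, 1, …`) through the backtracking loop
that starts from `L_k = L`: it is initialized as `max (L / 2) Llo`, and every pass begins by
replacing it by `min (2 * _) Lhi`. -/
def trial (A : AdaptiveSGD E S) (L : ℝ) : ℕ → ℝ
  | 0 => min (2 * max (L / 2) A.Llo) A.Lhi
  | i + 1 => min (2 * trial A L i) A.Lhi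

open Classical in
/-- The backtracking loop at the point `x` with the mini-batch gradient `g`: it returns the first
trial value that is accepted, and `none` if the loop runs forever. -/
def lineSearch (A : AdaptiveSGD E S) (x g : E) (L : ℝ) : Option ℝ :=
  if h : ∃ i, A.Accepts x g (A.trial L i) then some (A.trial L (Nat.find h)) else none

/-- One iteration, from the state `p = (x^k, L_k)` and the samples `s`. The mini-batch gradient is
the same in all passes through the backtracking loop. -/
def step (A : AdaptiveSGD E S) (s : ℕ → S) (p : State E) : Option (State E) :=
  let g := A.miniBatch p.x (A.batchSize p.L) s
  (A.lineSearch p.x g p.L).map fun L' => ⟨gradStep p.x g L', L'⟩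

/-- The state `(x^k, L_k)` after `k` iterations, where iteration number `k` (`k = 0, 1, …`) uses the
samples `ζ k 0, ζ k 1, …`. The value is `none` if an earlier backtracking loop runs forever. -/
def run (A : AdaptiveSGD E S) (ζ : ℕ → ℕ → S) : ℕ → Option (State E)
  | 0 => some ⟨A.x₀, A.L₀⟩
  | k + 1 => (run A ζ k).bind (A.step (ζ k))

/-- `(x^k, L_k)`, with a dummy value if the `k`-th state is not reached. -/
def stateAt (A : AdaptiveSGD E S) (ζ : ℕ → ℕ → S) (k : ℕ) : State E :=
  (A.run ζ k).getD ⟨A.x₀, A.L₀⟩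

/-- The output after `N` iterations: the average of `x^1, …, x^N` with weights proportional to
`1 / L_1, …, 1 / L_N`. There is no output if some backtracking loop runs forever. -/
def output (A : AdaptiveSGD E S) (ζ : ℕ → ℕ → S) : Option E :=
  (A.run ζ A.N).map fun _ =>
    (∑ k ∈ Finset.range A.N, 1 / (A.stateAt ζ (k + 1)).L)⁻¹ •
      ∑ k ∈ Finset.range A.N, (1 / (A.stateAt ζ (k + 1)).L) • (A.stateAt ζ (k + 1)).x

/-- The number of stochastic gradients computed: every iteration that is reached (also one whose
backtracking loop runs forever) computes one mini-batch. -/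
def oracleCalls (A : AdaptiveSGD E S) (ζ : ℕ → ℕ → S) : ℕ :=
  ∑ k ∈ Finset.range A.N, (A.run ζ k).elim 0 fun p => A.batchSize p.L

end AdaptiveSGD

/-- `f` is continuously differentiable and has an `L`-Lipschitz continuous gradient, in the sense
of the quadratic upper bound. -/
def HasLipschitzGradient {E : Type*} [NormedAddCommGroup E] [InnerProductSpace ℝ E]
    [CompleteSpace E] (f : E → ℝ) (L : ℝ) : Prop :=
  ContDiff ℝ 1 f ∧ ∀ x y, f y ≤ f x + inner ℝ (∇ f x) (y - x) + L / 2 * ‖x - y‖ ^ 2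

/-- `G x s`, with `s` distributed according to `ν`, is an unbiased stochastic gradient of `f` whose
noise is light-tailed: `𝔼 exp (‖G x s - ∇f(x)‖² / σ²) ≤ exp 1`. -/
structure IsLightTailedOracle {E S : Type*} [NormedAddCommGroup E] [InnerProductSpace ℝ E]
    [CompleteSpace E] [MeasurableSpace E] [MeasurableSpace S]
    (f : E → ℝ) (G : E → S → E) (ν : Measure S) (σ : ℝ) : Prop where
  measurable : Measurable fun p : E × S => G p.1 p.2
  integrable : ∀ x, Integrable (G x) ν
  unbiased : ∀ x, ∫ s, G x s ∂ν = ∇ f x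
  light_tailed : ∀ x,
    ∫⁻ s, ENNReal.ofReal (Real.exp (‖G x s - ∇ f x‖ ^ 2 / σ ^ 2)) ∂ν ≤ ENNReal.ofReal (Real.exp 1)

end

/-! Write `D k` for the squared distance of `x^k` to the minimizer, `h k = 1 / L_{k+1}`, and `F k`
for the gap `f (x^{k+1}) - f xstar`. Convexity and the stopping criterion give `D (k+1) + h k * F k
≤ D k + ε / 2 * h k - h k * ⟪noise, x^k - xstar⟫` (`sq_norm_gradStep_le`). Summing, it remains to
control the noise term and to know that every loop stops.

Two obstacles prevent a direct martingale bound: `h k` depends on the current batch, and `x^k -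
xstar` is not bounded a priori. Both are removed by summation by parts. Let `V k` be the running
maximum of `R ^ 2` and the squared distances. The components of the noise along `(x^k - xstar) / √(V
k)` form a martingale difference sequence with directions of norm at most 1, so their partial sums
`W` are sub-Gaussian. The weights `√(V k)` increase and the weights `h k` decrease, because the
estimates `L_k` never decrease; hence pathwise the full noise sum is at most `2 * h 0 * √(V n) * w`
when all `|W|` are at most `w`. Since this is linear in `√(V n)`, it is absorbed by the recursion,
which bounds `V` and the averaged gap together (`sum_mul_le_of_recursion`). No union over the
possible sequences of estimates is needed.

The loops stop because the trial values reach `Lhi` after boundedly many doublings, and `Lhi` is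
accepted as soon as the squared batch noise is at most `Lhi * ε` (`accepts_Lhi`). Its tail is
controlled by a dimension-free exponential moment of the squared norm of an i.i.d. sum
(`lintegral_exp_sq_norm_sum_le`).

Measurability is handled on a total process `track`, which coincides with the actual run on the good
event (`run_eq_track`). The bound on the oracle calls is deterministic: every batch is at most `κ *
B(Llo) + 1`. -/

/-! ### Exponential moments of light-tailed vectors -/

/-- The exponential moment of `X` is at most `exp c`, as witnessed by an integrable majorant. -/
def ExpMomentLE {S : Type*} [MeasurableSpace S] (ν : Measure S) (X : S → ℝ) (c : ℝ) : Prop :=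
  ∃ h : S → ℝ, Integrable h ν ∧ (∀ s, Real.exp (X s) ≤ h s) ∧ ∫ s, h s ∂ν ≤ Real.exp c

namespace ExpMomentLE

variable {S : Type*} [MeasurableSpace S] {ν : Measure S} {X Y : S → ℝ} {a b c : ℝ}

lemma lintegral_le (h : ExpMomentLE ν X c) :
    ∫⁻ s, ENNReal.ofReal (Real.exp (X s)) ∂ν ≤ ENNReal.ofReal (Real.exp c) := by
  obtain ⟨g, hg, hXg, hgc⟩ := h
  calc ∫⁻ s, ENNReal.ofReal (Real.exp (X s)) ∂ν ≤ ∫⁻ s, ENNReal.ofReal (g s) ∂ν :=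
        lintegral_mono fun s => ENNReal.ofReal_le_ofReal (hXg s)
    _ = ENNReal.ofReal (∫ s, g s ∂ν) := by
        rw [ofReal_integral_eq_lintegral_ofReal hg]
        exact ae_of_all _ fun s => (Real.exp_pos _).le.trans (hXg s)
    _ ≤ _ := ENNReal.ofReal_le_ofReal hgc

/-- The same majorant serves for `Y`, so that no measurability of `Y` has to be proved. -/
lemma mono (h : ExpMomentLE ν X c) (hY : ∀ s, Y s ≤ X s) (hc : c ≤ b) : ExpMomentLE ν Y b := by
  obtain ⟨g, hg, hXg, hgc⟩ := h
  exact ⟨g, hg, fun s => (Real.exp_le_exp.2 (hY s)).trans (hXg s), hgc.trans (Real.exp_le_exp.2 hc)⟩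

lemma const_add (h : ExpMomentLE ν X c) (a : ℝ) : ExpMomentLE ν (fun s => a + X s) (a + c) := by
  obtain ⟨g, hg, hXg, hgc⟩ := h
  refine ⟨fun s => Real.exp a * g s, hg.const_mul _, fun s => ?_, ?_⟩
  · rw [Real.exp_add]
    exact mul_le_mul_of_nonneg_left (hXg s) (Real.exp_pos _).le
  · rw [integral_const_mul, Real.exp_add]
    exact mul_le_mul_of_nonneg_left hgc (Real.exp_pos _).le

/-- A form of the Cauchy–Schwarz inequality. -/
lemma add (hX : ExpMomentLE ν (fun s => 2 * X s) (2 * a))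
    (hY : ExpMomentLE ν (fun s => 2 * Y s) (2 * b)) :
    ExpMomentLE ν (fun s => X s + Y s) (a + b) := by
  obtain ⟨g, hg, hXg, hgc⟩ := hX
  obtain ⟨k, hk, hYk, hkc⟩ := hY
  refine ⟨fun s => (1 / 2 * Real.exp (b - a)) * g s + (1 / 2 * Real.exp (a - b)) * k s,
    (hg.const_mul _).add (hk.const_mul _), fun s => ?_, ?_⟩
  · have h1 : Real.exp (X s + Y s) ≤ 1 / 2 * Real.exp (b - a) * Real.exp (2 * X s) +
        1 / 2 * Real.exp (a - b) * Real.exp (2 * Y s) := by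
      have e1 : Real.exp (b - a) * Real.exp (2 * X s) = Real.exp ((b - a) / 2 + X s) ^ 2 := by
        rw [← Real.exp_add, ← Real.exp_nat_mul]; congr 1; push_cast; ring
      have e2 : Real.exp (a - b) * Real.exp (2 * Y s) = Real.exp ((a - b) / 2 + Y s) ^ 2 := by
        rw [← Real.exp_add, ← Real.exp_nat_mul]; congr 1; push_cast; ring
      have e3 : Real.exp (X s + Y s) =
          Real.exp ((b - a) / 2 + X s) * Real.exp ((a - b) / 2 + Y s) := by
        rw [← Real.exp_add]; congr 1; ring
      rw [mul_assoc, mul_assoc, e1, e2, e3]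
      nlinarith [sq_nonneg (Real.exp ((b - a) / 2 + X s) - Real.exp ((a - b) / 2 + Y s))]
    refine h1.trans (add_le_add ?_ ?_)
    · exact mul_le_mul_of_nonneg_left (hXg s) (by positivity)
    · exact mul_le_mul_of_nonneg_left (hYk s) (by positivity)
  · rw [integral_add (hg.const_mul _) (hk.const_mul _), integral_const_mul, integral_const_mul]
    have e1 : Real.exp (b - a) * Real.exp (2 * a) = Real.exp (a + b) := by
      rw [← Real.exp_add]; congr 1; ring
    have e2 : Real.exp (a - b) * Real.exp (2 * b) = Real.exp (a + b) := by
      rw [← Real.exp_add]; congr 1; ring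
    have := mul_le_mul_of_nonneg_left hgc (Real.exp_pos (b - a)).le
    have := mul_le_mul_of_nonneg_left hkc (Real.exp_pos (a - b)).le
    linarith

/-- Jensen's inequality for the power `θ`: convexity of `exp` between `0` and `X - 1`, where `exp (X
- 1)` has mean at most 1. -/
lemma mul_of_le_one [IsProbabilityMeasure ν] (h : ExpMomentLE ν X 1) {θ : ℝ} (h0 : 0 ≤ θ)
    (h1 : θ ≤ 1) : ExpMomentLE ν (fun s => θ * X s) θ := by
  obtain ⟨g, hg, hXg, hgc⟩ := h
  refine ⟨fun s => Real.exp θ * ((1 - θ) + θ * (Real.exp (-1) * g s)),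
    ((integrable_const _).add ((hg.const_mul _).const_mul _)).const_mul _, fun s => ?_, ?_⟩
  · have h2 := convexOn_exp.2 (mem_univ (X s - 1)) (mem_univ (0 : ℝ)) h0 (sub_nonneg.2 h1)
      (by ring)
    simp only [smul_eq_mul, mul_zero, add_zero, Real.exp_zero, mul_one] at h2
    have h3 : Real.exp (X s - 1) ≤ Real.exp (-1) * g s := by
      rw [sub_eq_neg_add, Real.exp_add]
      exact mul_le_mul_of_nonneg_left (hXg s) (Real.exp_pos _).le
    have h4 : Real.exp (θ * X s) = Real.exp θ * Real.exp (θ * (X s - 1)) := by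
      rw [← Real.exp_add]; congr 1; ring
    rw [h4]
    refine mul_le_mul_of_nonneg_left ?_ (Real.exp_pos _).le
    nlinarith
  · rw [integral_const_mul, integral_add (integrable_const _) ((hg.const_mul _).const_mul _),
      integral_const_mul, integral_const_mul]
    simp only [integral_const, probReal_univ, smul_eq_mul, one_mul]
    have h3 : Real.exp (-1) * ∫ s, g s ∂ν ≤ 1 := by
      calc _ ≤ Real.exp (-1) * Real.exp 1 :=
            mul_le_mul_of_nonneg_left hgc (Real.exp_pos _).le
        _ = 1 := by rw [← Real.exp_add]; simp
    calc _ ≤ Real.exp θ * 1 := by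
          refine mul_le_mul_of_nonneg_left ?_ (Real.exp_pos _).le
          nlinarith
      _ = _ := mul_one _

end ExpMomentLE

/-- Used for centered variables: the linear term vanishes in the mean, and only the exponential of a
square is left. -/
lemma Real.exp_le_add_exp_sq (t : ℝ) : Real.exp t ≤ t + Real.exp (t ^ 2) := by
  have h2 : t ^ 2 + 1 ≤ Real.exp (t ^ 2) := Real.add_one_le_exp _
  rcases le_or_gt |t| 1 with h | h
  · have := (abs_le.1 (Real.abs_exp_sub_one_sub_id_le h)).2
    linarith
  · rcases le_total 0 t with h0 | h0
    · rw [abs_of_nonneg h0] at h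
      have : Real.exp t ≤ Real.exp (t ^ 2) := Real.exp_le_exp.2 (by nlinarith)
      linarith
    · rw [abs_of_nonpos h0] at h
      have : Real.exp t ≤ 1 := Real.exp_le_one_iff.2 h0
      nlinarith

/-! ### Sub-Gaussian estimates for one light-tailed vector -/

section LightTailed

variable {E S : Type*} [NormedAddCommGroup E] [InnerProductSpace ℝ E] [CompleteSpace E]
  [MeasurableSpace S] {ν : Measure S} [IsProbabilityMeasure ν] {D : S → E} {σ : ℝ}

/-- By Cauchy–Schwarz the squared inner product is at most `θ * X`, where `X = ‖D‖ ^ 2 / σ ^ 2`. For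
`θ ≤ 1`, `exp t ≤ t + exp (t ^ 2)` combined with the zero mean suffices. -/
lemma ExpMomentLE.inner_of_lightTailed (hσ : 0 < σ) (hD : Integrable D ν) (hmean : ∫ s, D s ∂ν = 0)
    (hlight : ExpMomentLE ν (fun s => ‖D s‖ ^ 2 / σ ^ 2) 1) (v : E) :
    ExpMomentLE ν (fun s => inner ℝ (D s) v) (σ ^ 2 * ‖v‖ ^ 2) := by
  have hσ2 : 0 < σ ^ 2 := by positivity
  set θ := σ ^ 2 * ‖v‖ ^ 2 with hθ
  have hθ0 : 0 ≤ θ := by positivity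
  have hcs : ∀ s, (inner ℝ (D s) v) ^ 2 ≤ θ * (‖D s‖ ^ 2 / σ ^ 2) := fun s => by
    have h1 : θ * (‖D s‖ ^ 2 / σ ^ 2) = (‖D s‖ * ‖v‖) ^ 2 := by rw [hθ]; field_simp
    rw [h1, ← sq_abs]
    gcongr
    exact abs_real_inner_le_norm _ _
  rcases le_total θ 1 with h1 | h1
  · obtain ⟨g, hg, hXg, hgc⟩ := hlight.mul_of_le_one hθ0 h1
    have hi : Integrable (fun s => (inner ℝ (D s) v : ℝ)) ν := hD.inner_const v
    refine ⟨fun s => inner ℝ (D s) v + g s, hi.add hg, fun s => ?_, ?_⟩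
    · refine (Real.exp_le_add_exp_sq _).trans ?_
      have := (Real.exp_le_exp.2 (hcs s)).trans (hXg s)
      linarith
    · rw [integral_add hi hg]
      have : ∫ s, (inner ℝ (D s) v : ℝ) ∂ν = 0 := by
        have h2 : ∀ s, (inner ℝ (D s) v : ℝ) = inner ℝ v (D s) := fun s => real_inner_comm _ _
        simp_rw [h2]
        rw [integral_inner hD, hmean, inner_zero_right]
      linarith
  -- For `θ ≥ 1` the mean is irrelevant: AM-GM gives `t ≤ θ / 2 + X / 2`, with exponential moment at
  -- most `exp (θ / 2 + 1 / 2) ≤ exp θ`.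
  · have h2 := (hlight.mul_of_le_one (θ := 1 / 2) (by norm_num) (by norm_num)).const_add (θ / 2)
    refine h2.mono (fun s => ?_) (by linarith)
    have h3 := hcs s
    have h4 : 0 ≤ ‖D s‖ ^ 2 / σ ^ 2 := by positivity
    nlinarith [sq_nonneg (θ - ‖D s‖ ^ 2 / σ ^ 2), abs_le_of_sq_le_sq' (a := inner ℝ (D s) v)
      (b := θ / 2 + 1 / 2 * (‖D s‖ ^ 2 / σ ^ 2)) (by nlinarith [sq_nonneg (θ - ‖D s‖ ^ 2 / σ ^ 2)])
      (by positivity)]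

/-- Expand the square and separate the cross term from `‖D‖ ^ 2` by Cauchy–Schwarz. Doubling the
exponents accounts for the vector `4 * b • u` and for the condition `2 * b * σ ^ 2 ≤ 1`. -/
lemma ExpMomentLE.sq_norm_add_of_lightTailed (hσ : 0 < σ) (hD : Integrable D ν)
    (hmean : ∫ s, D s ∂ν = 0) (hlight : ExpMomentLE ν (fun s => ‖D s‖ ^ 2 / σ ^ 2) 1) (u : E)
    {b : ℝ} (hb : 0 ≤ b) (hbσ : 2 * b * σ ^ 2 ≤ 1) :
    ExpMomentLE ν (fun s => b * ‖u + D s‖ ^ 2)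
      ((b + 8 * b ^ 2 * σ ^ 2) * ‖u‖ ^ 2 + b * σ ^ 2) := by
  have h1 := ExpMomentLE.inner_of_lightTailed hσ hD hmean hlight ((4 * b) • u)
  have h2 := hlight.mul_of_le_one (θ := 2 * b * σ ^ 2) (by positivity) hbσ
  have h3 : ExpMomentLE ν (fun s => 2 * (2 * b * inner ℝ (D s) u)) (2 * (8 * b ^ 2 * σ ^ 2 * ‖u‖ ^ 2)) := by
    refine h1.mono (fun s => ?_) ?_
    · rw [inner_smul_right]; apply le_of_eq; ring
    · rw [norm_smul, Real.norm_of_nonneg (by positivity)]; apply le_of_eq; ring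
  have h4 : ExpMomentLE ν (fun s => 2 * (b * ‖D s‖ ^ 2)) (2 * (b * σ ^ 2)) := by
    refine h2.mono (fun s => ?_) (by linarith)
    apply le_of_eq; field_simp
  refine ((h3.add h4).const_add (b * ‖u‖ ^ 2)).mono (fun s => ?_) (by apply le_of_eq; ring)
  rw [norm_add_sq_real, real_inner_comm]
  apply le_of_eq; ring

end LightTailed

/-! ### Independence -/

section Independence

variable {Ω α β : Type*} [MeasurableSpace Ω] {P : Measure Ω} [IsProbabilityMeasure P]
  [MeasurableSpace α] [MeasurableSpace β]

/-- Freezing: under independence, `X` is held fixed while `Y` is integrated out. -/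
lemma lintegral_comp_eq_of_indepFun {X : Ω → α} {Y : Ω → β} (hX : Measurable X) (hY : Measurable Y)
    (h : IndepFun X Y P) {F : α × β → ENNReal} (hF : Measurable F) :
    ∫⁻ ω, F (X ω, Y ω) ∂P = ∫⁻ ω, ∫⁻ y, F (X ω, y) ∂(P.map Y) ∂P := by
  have : IsProbabilityMeasure (P.map Y) := Measure.isProbabilityMeasure_map hY.aemeasurable
  have : IsProbabilityMeasure (P.map X) := Measure.isProbabilityMeasure_map hX.aemeasurable
  rw [← lintegral_map hF (hX.prodMk hY),
    (indepFun_iff_map_prod_eq_prod_map_map hX.aemeasurable hY.aemeasurable).1 h,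
    lintegral_prod _ hF.aemeasurable, lintegral_map hF.lintegral_prod_right' hX]

variable {ι : Type*} {S : Type*} [MeasurableSpace S] {ξ : ι → Ω → S}

/-- The σ-algebra generated by the `ξ i`, `i ∈ A`. -/
@[reducible] def sigmaOf (ξ : ι → Ω → S) (A : Set ι) : MeasurableSpace Ω :=
  ⨆ i ∈ A, MeasurableSpace.comap (ξ i) inferInstance

lemma sigmaOf_le (hξ : ∀ i, Measurable (ξ i)) (A : Set ι) : sigmaOf ξ A ≤ ‹MeasurableSpace Ω› :=
  iSup₂_le fun i _ => (hξ i).comap_le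

omit [MeasurableSpace Ω] in
lemma sigmaOf_mono {A B : Set ι} (h : A ⊆ B) : sigmaOf ξ A ≤ sigmaOf ξ B :=
  biSup_mono h

omit [MeasurableSpace Ω] in
lemma measurable_sigmaOf {A : Set ι} {i : ι} (hi : i ∈ A) : Measurable[sigmaOf ξ A] (ξ i) :=
  Measurable.mono (comap_measurable (ξ i))
    (le_iSup₂ (f := fun i (_ : i ∈ A) => MeasurableSpace.comap (ξ i) inferInstance) i hi) le_rfl

omit [IsProbabilityMeasure P] in
lemma indepFun_of_measurable_sigmaOf (hξ : ∀ i, Measurable (ξ i)) (h : iIndepFun ξ P) {A B : Set ι}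
    (hAB : Disjoint A B) {X : Ω → α} {Y : Ω → β} (hX : Measurable[sigmaOf ξ A] X)
    (hY : Measurable[sigmaOf ξ B] Y) : IndepFun X Y P := by
  have h1 : Indep (sigmaOf ξ A) (sigmaOf ξ B) P :=
    indep_iSup_of_disjoint (fun i => (hξ i).comap_le) h hAB
  exact indep_of_indep_of_le_left (indep_of_indep_of_le_right h1 hY.comap_le) hX.comap_le

end Independence

/-! ### Exponential moments of sums of independent vectors -/

section IIDSum

variable {Ω E S : Type*} [MeasurableSpace Ω] {P : Measure Ω} [IsProbabilityMeasure P]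
  [NormedAddCommGroup E] [InnerProductSpace ℝ E] [CompleteSpace E]
  [MeasurableSpace E] [BorelSpace E] [SecondCountableTopology E]
  [MeasurableSpace S] {ν : Measure S} [IsProbabilityMeasure ν] {D : S → E} {σ : ℝ}
  {η : ℕ → Ω → S}

omit [InnerProductSpace ℝ E] [CompleteSpace E] in
lemma measurable_sum_sigmaOf (hDm : Measurable D) (j : ℕ) :
    Measurable[sigmaOf η (Iio j)] fun ω => ∑ l ∈ Finset.range j, D (η l ω) := by
  refine Finset.measurable_fun_sum _ fun l hl => ?_
  exact hDm.comp (measurable_sigmaOf (Finset.mem_range.1 hl))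

omit [IsProbabilityMeasure ν] in
-- The last summand is independent of the earlier ones and is integrated out first. This is the
-- induction step for both moment bounds below.
lemma lintegral_exp_sum_succ_le (hη : ∀ l, Measurable (η l)) (hmap : ∀ l, P.map (η l) = ν)
    (hind : iIndepFun η P) (hDm : Measurable D) {φ ψ : E → ℝ} (hφ : Measurable φ) {j : ℕ}
    (h : ∀ u, ExpMomentLE ν (fun s => φ (u + D s)) (ψ u)) :
    ∫⁻ ω, ENNReal.ofReal (Real.exp (φ (∑ l ∈ Finset.range (j + 1), D (η l ω)))) ∂P ≤
      ∫⁻ ω, ENNReal.ofReal (Real.exp (ψ (∑ l ∈ Finset.range j, D (η l ω)))) ∂P := by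
  simp_rw [Finset.sum_range_succ]
  have hX := measurable_sum_sigmaOf (η := η) hDm j
  have hi : IndepFun (fun ω => ∑ l ∈ Finset.range j, D (η l ω)) (η j) P :=
    indepFun_of_measurable_sigmaOf hη hind (A := Iio j) (B := {j}) (by simp) hX
      (measurable_sigmaOf rfl)
  have hF : Measurable fun p : E × S => ENNReal.ofReal (Real.exp (φ (p.1 + D p.2))) := by
    fun_prop
  have := lintegral_comp_eq_of_indepFun (hX.mono (sigmaOf_le hη _) le_rfl) (hη j) hi hF
  simp only at this
  rw [this, hmap j]
  exact lintegral_mono fun ω => (h _).lintegral_le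

lemma lintegral_exp_inner_sum_le (hσ : 0 < σ) (hη : ∀ l, Measurable (η l))
    (hmap : ∀ l, P.map (η l) = ν) (hind : iIndepFun η P) (hDm : Measurable D)
    (hD : Integrable D ν) (hmean : ∫ s, D s ∂ν = 0)
    (hlight : ExpMomentLE ν (fun s => ‖D s‖ ^ 2 / σ ^ 2) 1) (v : E) (a : ℝ) (r : ℕ) :
    ∫⁻ ω, ENNReal.ofReal (Real.exp (a + inner ℝ (∑ l ∈ Finset.range r, D (η l ω)) v)) ∂P ≤
      ENNReal.ofReal (Real.exp (a + r * (σ ^ 2 * ‖v‖ ^ 2))) := by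
  induction r generalizing a with
  | zero => simp
  | succ r ih =>
    refine (lintegral_exp_sum_succ_le hη hmap hind hDm (φ := fun u => a + inner ℝ u v)
      (ψ := fun u => (a + σ ^ 2 * ‖v‖ ^ 2) + inner ℝ u v) (by fun_prop) fun u => ?_).trans
      ((ih _).trans (le_of_eq ?_))
    · refine ((ExpMomentLE.inner_of_lightTailed hσ hD hmean hlight v).const_add
        (a + inner ℝ u v)).mono (fun s => ?_) (by linarith)
      rw [inner_add_left]; linarith
    · push_cast; ring_nf

/-- Integrating out one summand enlarges the coefficient of the squared norm. The coefficient
therefore varies with `j`, so that one step leads exactly from the value for `j + 1` to the value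
for `j`, at a cost of at most `1 / (8 * r)` in the exponent. For `j = r` the total cost is `1 / 8`,
whatever the dimension. -/
lemma lintegral_exp_sq_norm_sum_le (hσ : 0 < σ) (hη : ∀ l, Measurable (η l))
    (hmap : ∀ l, P.map (η l) = ν) (hind : iIndepFun η P) (hDm : Measurable D)
    (hD : Integrable D ν) (hmean : ∫ s, D s ∂ν = 0)
    (hlight : ExpMomentLE ν (fun s => ‖D s‖ ^ 2 / σ ^ 2) 1) {r : ℕ} (hr : 1 ≤ r) (a : ℝ) (j : ℕ) :
    ∫⁻ ω, ENNReal.ofReal (Real.exp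
        (a + 1 / (8 * σ ^ 2 * (r + j)) * ‖∑ l ∈ Finset.range j, D (η l ω)‖ ^ 2)) ∂P ≤
      ENNReal.ofReal (Real.exp (a + j * (1 / (8 * r)))) := by
  have hr0 : (1 : ℝ) ≤ r := by exact_mod_cast hr
  induction j generalizing a with
  | zero => simp
  | succ j ih =>
    have hj0 : (0 : ℝ) ≤ j := by positivity
    refine (lintegral_exp_sum_succ_le hη hmap hind hDm
      (φ := fun u => a + 1 / (8 * σ ^ 2 * (r + (j + 1 : ℕ))) * ‖u‖ ^ 2)
      (ψ := fun u => (a + 1 / (8 * r)) + 1 / (8 * σ ^ 2 * (r + j)) * ‖u‖ ^ 2)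
      (by fun_prop) fun u => ?_).trans ((ih _).trans (le_of_eq ?_))
    · set b := 1 / (8 * σ ^ 2 * (r + (j + 1 : ℕ))) with hb
      have hc : (0 : ℝ) < r + (j + 1 : ℕ) := by positivity
      have hbσ : b * σ ^ 2 = 1 / (8 * (r + (j + 1 : ℕ))) := by rw [hb]; field_simp
      have hle : b * σ ^ 2 ≤ 1 / (8 * r) := by
        rw [hbσ]
        apply one_div_le_one_div_of_le (by positivity)
        push_cast; linarith
      have h8 : 1 / (8 * (r : ℝ)) ≤ 1 / 8 := by
        apply one_div_le_one_div_of_le <;> linarith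
      refine ((ExpMomentLE.sq_norm_add_of_lightTailed hσ hD hmean hlight u (b := b)
        (by positivity) (by linarith)).const_add a).mono (fun s => le_rfl) ?_
      -- With `n = r + j` this is `1 / (n + 1) + 1 / (n + 1) ^ 2 ≤ 1 / n`.
      have h1 : b + 8 * b ^ 2 * σ ^ 2 ≤ 1 / (8 * σ ^ 2 * (r + j)) := by
        rw [hb, le_div_iff₀ (by positivity)]
        push_cast
        field_simp
        nlinarith
      nlinarith [mul_le_mul_of_nonneg_right h1 (sq_nonneg ‖u‖)]
    · push_cast; ring_nf

end IIDSum

/-! ### The backtracking loop -/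

namespace AdaptiveSGD

section Backtracking

variable {E S : Type*} [NormedAddCommGroup E] [InnerProductSpace ℝ E] {A : AdaptiveSGD E S}

omit [NormedAddCommGroup E] [InnerProductSpace ℝ E] in
lemma trial_le (A : AdaptiveSGD E S) (L : ℝ) (i : ℕ) : A.trial L i ≤ A.Lhi := by
  cases i <;> exact min_le_right _ _

omit [NormedAddCommGroup E] [InnerProductSpace ℝ E] in
-- The first doubling undoes the halving, so the estimates never decrease along the run; the
-- summation by parts relies on this.
lemma le_trial {L : ℝ} (hlo : 0 < A.Llo) (hL : A.Llo ≤ L) (hL' : L ≤ A.Lhi) (i : ℕ) :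
    L ≤ A.trial L i := by
  induction i with
  | zero => exact le_min (by linarith [le_max_left (L / 2) A.Llo]) hL'
  | succ i ih => exact le_min (by linarith) hL'

omit [NormedAddCommGroup E] [InnerProductSpace ℝ E] in
lemma min_pow_mul_le_trial (hhi : 0 ≤ A.Lhi) (L : ℝ) (i : ℕ) :
    min (2 ^ (i + 1) * A.Llo) A.Lhi ≤ A.trial L i := by
  induction i with
  | zero =>
    refine min_le_min_right _ ?_
    have := le_max_right (L / 2) A.Llo
    linarith
  | succ i ih =>
    refine le_min ?_ (min_le_right _ _)
    have h1 : min (2 ^ (i + 2) * A.Llo) A.Lhi ≤ 2 * min (2 ^ (i + 1) * A.Llo) A.Lhi := by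
      rw [mul_min_of_nonneg _ _ zero_le_two]
      exact min_le_min (by rw [pow_succ]; linarith) (by linarith)
    linarith

lemma trial_eq_Lhi (hlo : 0 ≤ A.Llo) (hhi : 0 ≤ A.Lhi) {m : ℕ} (hm : A.Lhi ≤ 2 ^ m * A.Llo) (L : ℝ) :
    A.trial L m = A.Lhi := by
  refine le_antisymm (A.trial_le L m) (le_trans (le_min ?_ le_rfl)
    (A.min_pow_mul_le_trial hhi L m))
  have : (0 : ℝ) ≤ 2 ^ m * A.Llo := by positivity
  rw [pow_succ]; linarith

open Classical in
/-- The backtracking loop from the trial value `t`, cut off after `j` passes with the value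
`Lhi`. -/
noncomputable def search (A : AdaptiveSGD E S) (x g : E) : ℕ → ℝ → ℝ
  | 0, _ => A.Lhi
  | j + 1, t => if A.Accepts x g t then t else search A x g j (min (2 * t) A.Lhi)

/-- The accepted estimate if at most `m` passes are allowed before `Lhi` is taken. -/
noncomputable def nextL (A : AdaptiveSGD E S) (m : ℕ) (x g : E) (L : ℝ) : ℝ :=
  A.search x g m (A.trial L 0)

lemma search_le {x g : E} {j : ℕ} {t : ℝ} (ht : t ≤ A.Lhi) : A.search x g j t ≤ A.Lhi := by
  induction j generalizing t with
  | zero => exact le_rfl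
  | succ j ih =>
    rw [search]
    split_ifs
    · exact ht
    · exact ih (min_le_right _ _)

lemma le_search {x g : E} {j : ℕ} {t : ℝ} (h0 : 0 ≤ t) (ht : t ≤ A.Lhi) :
    t ≤ A.search x g j t := by
  induction j generalizing t with
  | zero => exact ht
  | succ j ih =>
    rw [search]
    split_ifs
    · exact le_rfl
    · have h1 : t ≤ min (2 * t) A.Lhi := le_min (by linarith) ht
      exact h1.trans (ih (h0.trans h1) (min_le_right _ _))

lemma accepts_search {x g : E} (h : A.Accepts x g A.Lhi) {j : ℕ} {t : ℝ} :
    A.Accepts x g (A.search x g j t) := by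
  induction j generalizing t with
  | zero => exact h
  | succ j ih =>
    rw [search]
    split_ifs with h1
    · exact h1
    · exact ih

/-- Induction on the number `j` of passes left after `i` rejections. The total `i + j` stays fixed,
and the last of these trial values is `Lhi`, which is accepted. -/
lemma lineSearch_eq_search {x g : E} (h : A.Accepts x g A.Lhi) {L : ℝ} {i j : ℕ}
    (hlast : A.trial L (i + j) = A.Lhi) (hi : ∀ i' < i, ¬ A.Accepts x g (A.trial L i')) :
    A.lineSearch x g L = some (A.search x g j (A.trial L i)) := by
  classical
  have first : ∀ {i : ℕ}, A.Accepts x g (A.trial L i) →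
      (∀ i' < i, ¬ A.Accepts x g (A.trial L i')) →
      A.lineSearch x g L = some (A.trial L i) := fun {i} h1 h2 => by
    rw [lineSearch, dif_pos ⟨i, h1⟩, (Nat.find_eq_iff (h := ⟨i, h1⟩)).2 ⟨h1, h2⟩]
  induction j generalizing i with
  | zero =>
    rw [add_zero] at hlast
    rw [search, ← hlast]
    exact first (by rwa [hlast]) hi
  | succ j ih =>
    rw [search]
    split_ifs with h1
    · exact first h1 hi
    · refine ih (i := i + 1) (by rwa [add_right_comm, add_assoc]) fun i' hi' => ?_
      rcases Nat.lt_succ_iff_lt_or_eq.1 hi' with h2 | rfl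
      · exact hi _ h2
      · exact h1

lemma lineSearch_eq_nextL {x g : E} (h : A.Accepts x g A.Lhi) {m : ℕ} {L : ℝ}
    (hm : A.trial L m = A.Lhi) : A.lineSearch x g L = some (A.nextL m x g L) :=
  lineSearch_eq_search h (by rwa [zero_add]) (by simp)

lemma nextL_le {m : ℕ} {x g : E} {L : ℝ} : A.nextL m x g L ≤ A.Lhi :=
  search_le (A.trial_le L 0)

lemma le_nextL (hlo : 0 < A.Llo) {m : ℕ} {x g : E} {L : ℝ} (hL : A.Llo ≤ L) (hL' : L ≤ A.Lhi) :
    L ≤ A.nextL m x g L := by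
  have h1 := le_trial hlo hL hL' 0
  exact h1.trans (le_search (by linarith) (A.trial_le L 0))

lemma run_mem_Icc (hlo : 0 < A.Llo) (h0 : A.L₀ ∈ Icc A.Llo A.Lhi) (ζ : ℕ → ℕ → S) {k : ℕ}
    {p : State E} (hp : A.run ζ k = some p) : p.L ∈ Icc A.Llo A.Lhi := by
  induction k generalizing p with
  | zero =>
    simp only [run, Option.some.injEq] at hp
    subst hp
    exact h0
  | succ k ih =>
    simp only [run, Option.bind_eq_some_iff] at hp
    obtain ⟨q, hq, hqp⟩ := hp
    have hqL := ih hq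
    simp only [step, Option.map_eq_some_iff] at hqp
    obtain ⟨L', hL', rfl⟩ := hqp
    simp only [lineSearch] at hL'
    split_ifs at hL' with h
    simp only [Option.some.injEq] at hL'
    subst hL'
    exact ⟨hqL.1.trans (le_trial hlo hqL.1 hqL.2 _), A.trial_le _ _⟩

end Backtracking

/-! ### Batch sizes -/

section BatchSize

variable {E S : Type*} [NormedAddCommGroup E] [InnerProductSpace ℝ E] {A : AdaptiveSGD E S}

omit [NormedAddCommGroup E] [InnerProductSpace ℝ E] in
lemma batchScale_anti (hΛ : 0 ≤ A.logFactor) (hε : 0 < A.ε) (hlo : 0 < A.Llo) {L L' : ℝ} (hL : 0 < L)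
    (hLL : L ≤ L') : A.batchScale L' ≤ A.batchScale L := by
  unfold batchScale
  gcongr

omit [NormedAddCommGroup E] [InnerProductSpace ℝ E] in
lemma one_le_batchSize (A : AdaptiveSGD E S) (L : ℝ) : 1 ≤ A.batchSize L := le_max_right _ _

omit [NormedAddCommGroup E] [InnerProductSpace ℝ E] in
lemma le_batchSize (A : AdaptiveSGD E S) (L : ℝ) : A.κ * A.batchScale L ≤ A.batchSize L :=
  (Nat.le_ceil _).trans (by exact_mod_cast le_max_left _ _)

omit [NormedAddCommGroup E] [InnerProductSpace ℝ E] in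
lemma batchSize_le {L b : ℝ} (hb : A.κ * A.batchScale L ≤ b) (hb0 : 0 ≤ b) :
    (A.batchSize L : ℝ) ≤ b + 1 := by
  rw [batchSize, Nat.cast_max]
  refine max_le ?_ (by push_cast; linarith)
  exact (Nat.cast_le.2 (Nat.ceil_mono hb)).trans (Nat.ceil_lt_add_one hb0).le

lemma oracleCalls_le (hκ : 0 ≤ A.κ) (hΛ : 0 ≤ A.logFactor) (hε : 0 < A.ε) (hlo : 0 < A.Llo)
    (h0 : A.L₀ ∈ Icc A.Llo A.Lhi) (ζ : ℕ → ℕ → S) :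
    (A.oracleCalls ζ : ℝ) ≤ A.N * (A.κ * A.batchScale A.Llo + 1) := by
  have hB : 0 ≤ A.κ * A.batchScale A.Llo := by unfold batchScale; positivity
  rw [oracleCalls, Nat.cast_sum]
  refine (Finset.sum_le_card_nsmul _ _ (A.κ * A.batchScale A.Llo + 1) fun k _ => ?_).trans
    (by simp [mul_add])
  rcases hp : A.run ζ k with _ | p
  · simp only [Option.elim_none, Nat.cast_zero]; linarith
  · have hpL := run_mem_Icc hlo h0 ζ hp
    exact batchSize_le (mul_le_mul_of_nonneg_left (batchScale_anti hΛ hε hlo hlo hpL.1) hκ) hB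

end BatchSize

/-! ### The method with bookkeeping -/

section Track

variable {E S : Type*} [NormedAddCommGroup E] [InnerProductSpace ℝ E] [CompleteSpace E]
  {A : AdaptiveSGD E S} {m : ℕ} {xstar : E} {R : ℝ}

/-- The mini-batch gradient at the state `p = (x, L, V, W)`. -/
noncomputable def batchGrad (A : AdaptiveSGD E S) (p : E × ℝ × ℝ × ℝ) (s : ℕ → S) : E :=
  A.miniBatch p.1 (A.batchSize p.2.1) s

/-- The direction `(x - xstar) / √V` in which the noise is accumulated. -/
noncomputable def noiseDir (xstar : E) (p : E × ℝ × ℝ × ℝ) : E := (√p.2.2.1)⁻¹ • (p.1 - xstar)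

/-- One iteration from the state `p = (x, L, V, W)`, where `V` is the running maximum of the squared
distances to `xstar`, and `W` the sum of the components of the noise along `noiseDir`. -/
noncomputable def trackStep (A : AdaptiveSGD E S) (m : ℕ) (xstar : E) (p : E × ℝ × ℝ × ℝ)
    (s : ℕ → S) : E × ℝ × ℝ × ℝ :=
  let g := A.batchGrad p s
  let L' := A.nextL m p.1 g p.2.1
  let x' := gradStep p.1 g L'
  (x', L', max p.2.2.1 (‖x' - xstar‖ ^ 2), p.2.2.2 + inner ℝ (g - ∇ A.f p.1) (noiseDir xstar p))

/-- The states of the method with bookkeeping. -/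
noncomputable def track (A : AdaptiveSGD E S) (m : ℕ) (xstar : E) (R : ℝ) (ζ : ℕ → ℕ → S) :
    ℕ → E × ℝ × ℝ × ℝ
  | 0 => (A.x₀, A.L₀, R ^ 2, 0)
  | k + 1 => trackStep A m xstar (track A m xstar R ζ k) (ζ k)

lemma track_L_mem (hlo : 0 < A.Llo) (h0 : A.L₀ ∈ Icc A.Llo A.Lhi) (ζ : ℕ → ℕ → S) (k : ℕ) :
    (A.track m xstar R ζ k).2.1 ∈ Icc A.Llo A.Lhi := by
  induction k with
  | zero => exact h0
  | succ k ih => exact ⟨ih.1.trans (le_nextL hlo ih.1 ih.2), nextL_le⟩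

lemma track_L_le_succ (hlo : 0 < A.Llo) (h0 : A.L₀ ∈ Icc A.Llo A.Lhi) (ζ : ℕ → ℕ → S) (k : ℕ) :
    (A.track m xstar R ζ k).2.1 ≤ (A.track m xstar R ζ (k + 1)).2.1 :=
  le_nextL hlo (track_L_mem hlo h0 ζ k).1 (track_L_mem hlo h0 ζ k).2

lemma sq_le_track_V (ζ : ℕ → ℕ → S) (k : ℕ) : R ^ 2 ≤ (A.track m xstar R ζ k).2.2.1 := by
  induction k with
  | zero => exact le_rfl
  | succ k ih => exact ih.trans (le_max_left _ _)

lemma sq_norm_le_track_V (hR : ‖A.x₀ - xstar‖ ≤ R) (ζ : ℕ → ℕ → S) (k : ℕ) :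
    ‖(A.track m xstar R ζ k).1 - xstar‖ ^ 2 ≤ (A.track m xstar R ζ k).2.2.1 := by
  cases k with
  | zero => exact pow_le_pow_left₀ (norm_nonneg _) hR 2
  | succ k => exact le_max_right _ _

/-- `V` dominates the current squared distance and is known before the current batch is drawn, so
`noiseDir` is a predictable direction in the unit ball. -/
lemma norm_noiseDir_track_le (hR : ‖A.x₀ - xstar‖ ≤ R) (ζ : ℕ → ℕ → S) (k : ℕ) :
    ‖noiseDir xstar (A.track m xstar R ζ k)‖ ≤ 1 := by
  rw [noiseDir, norm_smul, norm_inv, Real.norm_of_nonneg (Real.sqrt_nonneg _)]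
  exact inv_mul_le_one_of_le₀
    (Real.le_sqrt_of_sq_le (sq_norm_le_track_V hR ζ k)) (Real.sqrt_nonneg _)

/-- Transfers statements about `track`, which is total and measurable, to the actual method. -/
lemma run_eq_track {ζ : ℕ → ℕ → S} (hm : ∀ L, A.trial L m = A.Lhi) {n : ℕ}
    (h : ∀ k < n, A.Accepts (A.track m xstar R ζ k).1
      (A.batchGrad (A.track m xstar R ζ k) (ζ k)) A.Lhi) :
    A.run ζ n = some ⟨(A.track m xstar R ζ n).1, (A.track m xstar R ζ n).2.1⟩ := by
  induction n with
  | zero => rfl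
  | succ n ih =>
    rw [run, ih fun k hk => h k (hk.trans n.lt_succ_self), Option.bind_some, step]
    simp only
    have := lineSearch_eq_nextL (h n n.lt_succ_self) (hm (A.track m xstar R ζ n).2.1)
    unfold batchGrad at this
    rw [this]
    rfl

/-! ### Measurability of the process with bookkeeping -/

variable [MeasurableSpace E] [BorelSpace E] [SecondCountableTopology E] [MeasurableSpace S]

omit [CompleteSpace E] in
lemma measurable_miniBatch (hG : Measurable fun p : E × S => A.G p.1 p.2) :
    Measurable fun q : ℕ × (E × (ℕ → S)) => A.miniBatch q.2.1 q.1 q.2.2 := by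
  -- The batch size is random but integer-valued, so each fixed `r` can be treated separately.
  refine measurable_from_prod_countable_right fun r => ?_
  have h : Measurable fun q : E × (ℕ → S) => ∑ l ∈ Finset.range r, A.G q.1 (q.2 l) :=
    Finset.measurable_fun_sum _ fun l _ =>
      hG.comp (measurable_fst.prodMk ((measurable_pi_apply l).comp measurable_snd))
  exact h.const_smul (1 / (r : ℝ))

omit [CompleteSpace E] [MeasurableSpace E] [BorelSpace E] [SecondCountableTopology E]
  [MeasurableSpace S] in
omit [NormedAddCommGroup E] [InnerProductSpace ℝ E] in
lemma measurable_batchSize (A : AdaptiveSGD E S) : Measurable A.batchSize := by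
  have h : Measurable fun L => A.κ * A.batchScale L := by unfold batchScale; fun_prop
  exact (Nat.measurable_ceil.comp h).max measurable_const

omit [CompleteSpace E] in
lemma measurable_batchGrad (hG : Measurable fun p : E × S => A.G p.1 p.2) :
    Measurable fun q : (E × ℝ × ℝ × ℝ) × (ℕ → S) => A.batchGrad q.1 q.2 := by
  have h1 : Measurable fun q : (E × ℝ × ℝ × ℝ) × (ℕ → S) => q.1.2.1 := by fun_prop
  have h2 : Measurable fun q : (E × ℝ × ℝ × ℝ) × (ℕ → S) => A.batchSize q.1.2.1 :=
    (measurable_batchSize A).comp h1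
  have h3 : Measurable ((fun q : ℕ × (E × (ℕ → S)) => A.miniBatch q.2.1 q.1 q.2.2) ∘
      fun q : (E × ℝ × ℝ × ℝ) × (ℕ → S) => (A.batchSize q.1.2.1, (q.1.1, q.2))) :=
    (measurable_miniBatch hG).comp
      (h2.prodMk ((measurable_fst.comp measurable_fst).prodMk measurable_snd))
  exact h3

omit [CompleteSpace E] [MeasurableSpace S] in
lemma measurableSet_accepts (hf : Continuous A.f) {Z : Type*} [MeasurableSpace Z] {x g : Z → E}
    {t : Z → ℝ} (hx : Measurable x) (hg : Measurable g) (ht : Measurable t) :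
    MeasurableSet {z | A.Accepts (x z) (g z) (t z)} := by
  have hfm := hf.measurable
  unfold Accepts gradStep
  refine measurableSet_le ?_ ?_ <;> fun_prop

lemma measurable_search (hf : Continuous A.f) {Z : Type*} [MeasurableSpace Z] {x g : Z → E}
    {t : Z → ℝ} (hx : Measurable x) (hg : Measurable g) (ht : Measurable t) (j : ℕ) :
    Measurable fun z => A.search (x z) (g z) j (t z) := by
  induction j generalizing t with
  | zero => exact measurable_const
  | succ j ih =>
    simp only [search]
    exact Measurable.ite (measurableSet_accepts hf hx hg ht) ht
      (ih ((ht.const_mul 2).min measurable_const))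

lemma measurable_nextL (hf : Continuous A.f) {Z : Type*} [MeasurableSpace Z] {x g : Z → E}
    {L : Z → ℝ} (hx : Measurable x) (hg : Measurable g) (hL : Measurable L) :
    Measurable fun z => A.nextL m (x z) (g z) (L z) := by
  refine measurable_search hf hx hg ?_ m
  simp only [trial]
  fun_prop

omit [CompleteSpace E] in
lemma measurable_noiseDir (xstar : E) : Measurable (noiseDir xstar) := by
  unfold noiseDir
  fun_prop

lemma measurable_trackStep (hf : Continuous A.f) (hf' : Continuous (∇ A.f))
    (hG : Measurable fun p : E × S => A.G p.1 p.2) :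
    Measurable fun q : (E × ℝ × ℝ × ℝ) × (ℕ → S) => A.trackStep m xstar q.1 q.2 := by
  have hg := measurable_batchGrad hG
  have hL : Measurable fun q : (E × ℝ × ℝ × ℝ) × (ℕ → S) =>
      A.nextL m q.1.1 (A.batchGrad q.1 q.2) q.1.2.1 :=
    measurable_nextL hf (by fun_prop) hg (by fun_prop)
  have hx : Measurable fun q : (E × ℝ × ℝ × ℝ) × (ℕ → S) =>
      gradStep q.1.1 (A.batchGrad q.1 q.2) (A.nextL m q.1.1 (A.batchGrad q.1 q.2) q.1.2.1) := by
    unfold gradStep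
    fun_prop
  have hd := measurable_noiseDir xstar
  have hfm := hf'.measurable
  unfold trackStep
  refine hx.prodMk (hL.prodMk (Measurable.prodMk ?_ ?_)) <;> fun_prop

/-- Adaptedness: the state after `k` iterations depends on the sample rows before `k` only. -/
lemma measurable_track {Ω : Type*} [MeasurableSpace Ω] {ξ : ℕ → ℕ → Ω → S} (hf : Continuous A.f)
    (hf' : Continuous (∇ A.f)) (hG : Measurable fun p : E × S => A.G p.1 p.2) (k : ℕ) :
    Measurable[sigmaOf (fun p : ℕ × ℕ => ξ p.1 p.2) {p | p.1 < k}]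
      fun ω => A.track m xstar R (fun k l => ξ k l ω) k := by
  induction k with
  | zero => exact measurable_const
  | succ k ih =>
    have h1 := ih.mono (sigmaOf_mono (B := {p : ℕ × ℕ | p.1 < k + 1})
      fun p (hp : p.1 < k) => hp.trans k.lt_succ_self) le_rfl
    have h2 : Measurable[sigmaOf (fun p : ℕ × ℕ => ξ p.1 p.2) {p | p.1 < k + 1}]
        fun ω l => ξ k l ω :=
      @measurable_pi_lambda _ _ _ (sigmaOf _ _) _ _ fun l =>
        measurable_sigmaOf (i := (k, l)) (ξ := fun p : ℕ × ℕ => ξ p.1 p.2) k.lt_succ_self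
    exact (measurable_trackStep hf hf' hG).comp (h1.prodMk h2)

end Track

end AdaptiveSGD

/-! ### Summation by parts -/

/-- Abel summation. The estimate is pathwise, so the weights `a` may depend on `Z`. -/
lemma abs_sum_mul_sub_le_of_monotone {a Z : ℕ → ℝ} (ha : Monotone a) {w : ℝ} {n : ℕ}
    (hZ : ∀ j ≤ n, |∑ k ∈ Finset.range j, Z k| ≤ w) :
    |∑ k ∈ Finset.range n, a k * Z k - a n * ∑ k ∈ Finset.range n, Z k| ≤ (a n - a 0) * w := by
  induction n with
  | zero => simp
  | succ n ih =>
    have h1 := ih fun j hj => hZ j (hj.trans n.le_succ)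
    have h2 : (a (n + 1) - a n) * |∑ k ∈ Finset.range (n + 1), Z k| ≤ (a (n + 1) - a n) * w :=
      mul_le_mul_of_nonneg_left (hZ _ le_rfl) (sub_nonneg.2 (ha n.le_succ))
    have h3 : ∑ k ∈ Finset.range (n + 1), a k * Z k - a (n + 1) * ∑ k ∈ Finset.range (n + 1), Z k =
        (∑ k ∈ Finset.range n, a k * Z k - a n * ∑ k ∈ Finset.range n, Z k) -
          (a (n + 1) - a n) * ∑ k ∈ Finset.range (n + 1), Z k := by
      rw [Finset.sum_range_succ, Finset.sum_range_succ Z]; ring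
    rw [h3]
    refine (abs_sub _ _).trans ?_
    rw [abs_mul, abs_of_nonneg (sub_nonneg.2 (ha n.le_succ))]
    linarith

lemma abs_sum_mul_le_of_monotone {a Z : ℕ → ℝ} (ha : Monotone a) (ha0 : 0 ≤ a 0) {w : ℝ} {n : ℕ}
    (hZ : ∀ j ≤ n, |∑ k ∈ Finset.range j, Z k| ≤ w) :
    |∑ k ∈ Finset.range n, a k * Z k| ≤ 2 * a n * w := by
  have h1 := abs_sum_mul_sub_le_of_monotone ha hZ
  have h2 := hZ n le_rfl
  have hw : 0 ≤ w := (abs_nonneg _).trans h2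
  have han : 0 ≤ a n := ha0.trans (ha n.zero_le)
  have h3 := abs_sub_abs_le_abs_sub (∑ k ∈ Finset.range n, a k * Z k)
    (a n * ∑ k ∈ Finset.range n, Z k)
  rw [abs_mul, abs_of_nonneg han] at h3
  nlinarith [mul_le_mul_of_nonneg_left h2 han]

lemma abs_sum_mul_le_of_antitone {a Z : ℕ → ℝ} (ha : Antitone a) {w : ℝ} {n : ℕ} (han : 0 ≤ a n)
    (hZ : ∀ j ≤ n, |∑ k ∈ Finset.range j, Z k| ≤ w) :
    |∑ k ∈ Finset.range n, a k * Z k| ≤ a 0 * w := by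
  have h1 := abs_sum_mul_sub_le_of_monotone (a := fun k => -a k) (fun _ _ h => neg_le_neg (ha h)) hZ
  simp only [neg_mul, Finset.sum_neg_distrib] at h1
  rw [← abs_neg] at h1
  have h2 := hZ n le_rfl
  have h3 := abs_sub_abs_le_abs_sub (∑ k ∈ Finset.range n, a k * Z k)
    (a n * ∑ k ∈ Finset.range n, Z k)
  rw [abs_mul, abs_of_nonneg han] at h3
  have h4 : -(-∑ k ∈ Finset.range n, a k * Z k - -(a n * ∑ k ∈ Finset.range n, Z k)) =
    ∑ k ∈ Finset.range n, a k * Z k - a n * ∑ k ∈ Finset.range n, Z k := by ring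
  rw [h4] at h1
  nlinarith [mul_le_mul_of_nonneg_left h2 han]

/-- The recursion `D (k+1) + h k * F k ≤ D k + ε / 2 * h k - h k * √(V k) * Z k`, in which `V` is the
running maximum of `D`, bounds `∑ h k * F k`, provided that the partial sums of `Z` are small. -/
lemma sum_mul_le_of_recursion {D V F h Z : ℕ → ℝ} {R ε w : ℝ} {N : ℕ} (hε : 0 ≤ ε)
    (hD0 : D 0 ≤ R ^ 2) (hDn : ∀ k, 0 ≤ D k) (hV0 : V 0 = R ^ 2)
    (hV : ∀ k, V (k + 1) = max (V k) (D (k + 1)))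
    (hF : ∀ k, 0 ≤ F k) (hh : ∀ k, 0 < h k) (hanti : Antitone h)
    (hrec : ∀ k < N, D (k + 1) + h k * F k ≤ D k + ε / 2 * h k - h k * (√(V k) * Z k))
    (hZ : ∀ j ≤ N, |∑ k ∈ Finset.range j, Z k| ≤ w) (hw : 16 * (h 0 * w) ≤ R)
    (hN : 4 * R ^ 2 ≤ ε * ∑ k ∈ Finset.range N, h k) :
    ∑ k ∈ Finset.range N, h k * F k ≤ ε * ∑ k ∈ Finset.range N, h k := by
  have hVm : Monotone V := monotone_nat_of_le_succ fun k => by rw [hV]; exact le_max_left _ _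
  have hVp : ∀ k, 0 ≤ V k := fun k => by
    have := hVm k.zero_le
    rw [hV0] at this
    exact (sq_nonneg R).trans this
  have hnoise : ∀ n ≤ N, |∑ k ∈ Finset.range n, h k * (√(V k) * Z k)| ≤ (R ^ 2 + V n) / 16 :=
    fun n hn => by
    -- First summation by parts, removing the increasing weights `√(V k)`; the one for the
    -- decreasing `h` follows. The result `2 * h 0 * w * √(V n) ≤ R * √(V n) / 8` is split by AM-GM.
    have h1 : ∀ j ≤ n, |∑ k ∈ Finset.range j, √(V k) * Z k| ≤ 2 * √(V n) * w := fun j hj => by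
      have hw0 : 0 ≤ w := (abs_nonneg _).trans (hZ 0 N.zero_le)
      refine (abs_sum_mul_le_of_monotone (a := fun k => √(V k))
        (fun _ _ h => Real.sqrt_le_sqrt (hVm h)) (Real.sqrt_nonneg _)
        fun i hi => hZ i (hi.trans (hj.trans hn))).trans ?_
      have := Real.sqrt_le_sqrt (hVm hj)
      gcongr
    have h2 := abs_sum_mul_le_of_antitone hanti (hh n).le h1
    have h3 := Real.sq_sqrt (hVp n)
    have h4 := Real.sqrt_nonneg (V n)
    nlinarith [sq_nonneg (R - √(V n)), mul_le_mul_of_nonneg_left hw h4]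
  have htel : ∀ n ≤ N, D n + ∑ k ∈ Finset.range n, h k * F k ≤
      R ^ 2 + ε / 2 * ∑ k ∈ Finset.range n, h k -
        ∑ k ∈ Finset.range n, h k * (√(V k) * Z k) := fun n hn => by
    induction n with
    | zero => simpa using hD0
    | succ n ih =>
      have h1 := ih (n.le_succ.trans hn)
      have h2 := hrec n hn
      rw [Finset.sum_range_succ, Finset.sum_range_succ, Finset.sum_range_succ]
      linarith
  have hHn : ∀ n, 0 ≤ ∑ k ∈ Finset.range n, h k := fun n => Finset.sum_nonneg fun k _ => (hh k).le
  have hFn : ∀ n, 0 ≤ ∑ k ∈ Finset.range n, h k * F k := fun n =>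
    Finset.sum_nonneg fun k _ => mul_nonneg (hh k).le (hF k)
  have hVle : ∀ n ≤ N, V n ≤ 2 * R ^ 2 + ε * ∑ k ∈ Finset.range n, h k := fun n hn => by
    induction n with
    | zero => simp [hV0]; nlinarith
    | succ n ih =>
      have h1 := ih (n.le_succ.trans hn)
      -- If the maximum is attained by the new distance, the noise bound contains `V (n + 1) / 16`,
      -- which is absorbed on the left.
      rcases max_choice (V n) (D (n + 1)) with h2 | h2
      · rw [hV, h2, Finset.sum_range_succ]
        nlinarith [mul_nonneg hε (hh n).le]
      · have h3 := htel (n + 1) hn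
        have h4 := (abs_le.1 (hnoise (n + 1) hn)).1
        have h5 := hFn (n + 1)
        have h6 := mul_nonneg hε (hHn (n + 1))
        rw [hV, h2] at h4 ⊢
        nlinarith [sq_nonneg R]
  have h1 := htel N le_rfl
  have h2 := (abs_le.1 (hnoise N le_rfl)).1
  have h3 := hVle N le_rfl
  have h4 := hDn N
  -- The sum is at most `19 / 16 * R ^ 2 + 9 / 16 * ε * ∑ h`, and `4 * R ^ 2 ≤ ε * ∑ h`.
  nlinarith

/-! ### One accepted step -/

section Descent

variable {E S : Type*} [NormedAddCommGroup E] [InnerProductSpace ℝ E] [CompleteSpace E]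

lemma ConvexOn.add_inner_gradient_le {f : E → ℝ} (hf : ConvexOn ℝ univ f) {x : E}
    (hd : DifferentiableAt ℝ f x) (y : E) : f x + inner ℝ (∇ f x) (y - x) ≤ f y := by
  have hline : ConvexOn ℝ univ (f ∘ AffineMap.lineMap (k := ℝ) x y) := by
    simpa using hf.comp_affineMap (AffineMap.lineMap (k := ℝ) x y)
  have hder : HasDerivAt (f ∘ AffineMap.lineMap (k := ℝ) x y) (inner ℝ (∇ f x) (y - x)) 0 := by
    have h1 : HasDerivAt (AffineMap.lineMap (k := ℝ) x y) (y - x) (0 : ℝ) :=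
      AffineMap.hasDerivAt_lineMap
    have h2 : HasFDerivAt f (fderiv ℝ f x) (AffineMap.lineMap (k := ℝ) x y 0) := by
      simpa using hd.hasFDerivAt
    have h3 := h2.comp_hasDerivAt (0 : ℝ) h1
    rwa [← hd.hasGradientAt.fderiv_apply]
  have := hline.le_slope_of_hasDerivAt (mem_univ 0) (mem_univ 1) zero_lt_one hder
  simp only [slope, sub_zero, inv_one, Function.comp_apply, AffineMap.lineMap_apply_one,
    AffineMap.lineMap_apply_zero, vsub_eq_sub, one_smul] at this
  linarith

namespace AdaptiveSGD

variable {A : AdaptiveSGD E S}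

/-- Of the term `Lhi * ‖y - x‖ ^ 2` in the criterion, one half pays for the smoothness of `f`; the
other half, together with `ε / 2`, pays for the noise by Young's inequality. -/
lemma accepts_Lhi {L : ℝ} (hf : HasLipschitzGradient A.f L) (hL : L ≤ A.Lhi) (hhi : 0 < A.Lhi)
    {x g : E} (hg : ‖g - ∇ A.f x‖ ^ 2 ≤ A.Lhi * A.ε) : A.Accepts x g A.Lhi := by
  unfold Accepts
  set y := gradStep x g A.Lhi
  have h1 := hf.2 x y
  rw [norm_sub_rev] at h1
  have h2 : inner ℝ (∇ A.f x) (y - x) = inner ℝ g (y - x) - inner ℝ (g - ∇ A.f x) (y - x) := by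
    rw [inner_sub_left]; ring
  have h3 : -inner ℝ (g - ∇ A.f x) (y - x) ≤ ‖g - ∇ A.f x‖ * ‖y - x‖ :=
    (neg_le_abs _).trans (abs_real_inner_le_norm _ _)
  have h4 : ‖g - ∇ A.f x‖ * ‖y - x‖ ≤ A.ε / 2 + A.Lhi / 2 * ‖y - x‖ ^ 2 := by
    refine le_of_mul_le_mul_left ?_ hhi
    nlinarith [sq_nonneg (‖g - ∇ A.f x‖ - A.Lhi * ‖y - x‖)]
  have h5 : L / 2 * ‖y - x‖ ^ 2 ≤ A.Lhi / 2 * ‖y - x‖ ^ 2 := by gcongr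
  linarith

/-- With step size `1 / (2 * L)` the decrease granted by the criterion is `‖g‖ ^ 2 / (4 * L)` up to
`ε / 2`, and this cancels the quadratic term in the expansion of the squared distance. Convexity at
`x` replaces `f x` by `f y`. -/
lemma sq_norm_gradStep_le (hf : ConvexOn ℝ univ A.f) (hd : Differentiable ℝ A.f) {x g : E} {L : ℝ}
    (hL : 0 < L) (h : A.Accepts x g L) (y : E) :
    ‖gradStep x g L - y‖ ^ 2 + 1 / L * (A.f (gradStep x g L) - A.f y) ≤
      ‖x - y‖ ^ 2 + A.ε / 2 * (1 / L) - 1 / L * inner ℝ (g - ∇ A.f x) (x - y) := by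
  have h1 := hf.add_inner_gradient_le (hd x) y
  have h2 : gradStep x g L - x = -((1 / (2 * L)) • g) := by rw [gradStep]; abel
  have h3 : gradStep x g L - y = (x - y) - (1 / (2 * L)) • g := by rw [gradStep]; abel
  unfold Accepts at h
  have h4 : inner ℝ (∇ A.f x) (y - x) = inner ℝ (g - ∇ A.f x) (x - y) - inner ℝ g (x - y) := by
    rw [← neg_sub x y, inner_neg_right, inner_sub_left]; ring
  rw [h2, inner_neg_right, inner_smul_right, norm_neg, norm_smul, real_inner_self_eq_norm_sq,
    Real.norm_of_nonneg (by positivity)] at h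
  rw [h3, norm_sub_sq_real, inner_smul_right, norm_smul, Real.norm_of_nonneg (by positivity),
    real_inner_comm]
  have h5 : L * (1 / (2 * L) * ‖g‖) ^ 2 = 1 / (4 * L) * ‖g‖ ^ 2 := by field_simp; ring
  have h6 : (1 / (2 * L) * ‖g‖) ^ 2 = 1 / L * (1 / (4 * L) * ‖g‖ ^ 2) := by field_simp; ring
  have h7 : 1 / (2 * L) * ‖g‖ ^ 2 = 2 * (1 / (4 * L) * ‖g‖ ^ 2) := by field_simp; ring
  have h8 : 2 * (1 / (2 * L) * inner ℝ g (x - y)) = 1 / L * inner ℝ g (x - y) := by field_simp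
  rw [h5, h7] at h
  rw [h6, h8]
  have h9 : A.f (gradStep x g L) - A.f y + 1 / (4 * L) * ‖g‖ ^ 2 ≤
      A.ε / 2 - inner ℝ (g - ∇ A.f x) (x - y) + inner ℝ g (x - y) := by linarith
  have h10 := mul_le_mul_of_nonneg_left h9 (by positivity : 0 ≤ 1 / L)
  linarith

lemma output_gap_le {L R w : ℝ} {m : ℕ} {xstar : E} {ζ : ℕ → ℕ → S} (hf : ConvexOn ℝ univ A.f)
    (hlip : HasLipschitzGradient A.f L) (hmin : IsMinOn A.f univ xstar)
    (hR : ‖A.x₀ - xstar‖ ≤ R) (hR0 : 0 < R) (hlo : 0 < A.Llo) (hL : L ≤ A.Lhi)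
    (h0 : A.L₀ ∈ Icc A.Llo A.Lhi) (hm : A.Lhi ≤ 2 ^ m * A.Llo) (hε : 0 < A.ε)
    (hN : 4 * (A.Lhi * R ^ 2 / A.ε) ≤ A.N) (hw : 16 * w ≤ A.Llo * R)
    (hnoise : ∀ k < A.N, ‖A.batchGrad (A.track m xstar R ζ k) (ζ k) -
      ∇ A.f (A.track m xstar R ζ k).1‖ ^ 2 ≤ A.Lhi * A.ε)
    (hW : ∀ j ≤ A.N, |(A.track m xstar R ζ j).2.2.2| ≤ w) :
    ∃ xbar, A.output ζ = some xbar ∧ A.f xbar - A.f xstar ≤ A.ε := by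
  have hhi : 0 < A.Lhi := hlo.trans_le (h0.1.trans h0.2)
  have hd : Differentiable ℝ A.f := hlip.1.differentiable (by norm_num)
  set p := A.track m xstar R ζ with hp
  have hacc : ∀ k < A.N, A.Accepts (p k).1 (A.batchGrad (p k) (ζ k)) A.Lhi := fun k hk =>
    accepts_Lhi hlip hL hhi (hnoise k hk)
  have hrun : ∀ n ≤ A.N, A.run ζ n = some ⟨(p n).1, (p n).2.1⟩ := fun n hn =>
    run_eq_track (fun L => trial_eq_Lhi hlo.le hhi.le hm L) fun k hk => hacc k (hk.trans_le hn)
  have hstate : ∀ k < A.N, A.stateAt ζ (k + 1) = ⟨(p (k + 1)).1, (p (k + 1)).2.1⟩ := fun k hk => by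
    rw [stateAt, hrun _ hk, Option.getD_some]
  have hpL : ∀ k, (p k).2.1 ∈ Icc A.Llo A.Lhi := track_L_mem hlo h0 ζ
  have hpL0 : ∀ k, 0 < (p k).2.1 := fun k => hlo.trans_le (hpL k).1
  set h : ℕ → ℝ := fun k => 1 / (p (k + 1)).2.1 with hh
  have hh0 : ∀ k, 0 < h k := fun k => one_div_pos.2 (hpL0 _)
  have hV0 : ∀ k, 0 < (p k).2.2.1 := fun k => (pow_pos hR0 2).trans_le (sq_le_track_V ζ k)
  have hN0 : 0 < A.N := by
    have : (0 : ℝ) < A.N := lt_of_lt_of_le (by positivity) hN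
    exact_mod_cast this
  have hH : 0 < ∑ k ∈ Finset.range A.N, h k :=
    Finset.sum_pos (fun k _ => hh0 k) (Finset.nonempty_range_iff.2 hN0.ne')
  have key : ∑ k ∈ Finset.range A.N, h k * (A.f (p (k + 1)).1 - A.f xstar) ≤
      A.ε * ∑ k ∈ Finset.range A.N, h k := by
    refine sum_mul_le_of_recursion (D := fun k => ‖(p k).1 - xstar‖ ^ 2) (V := fun k => (p k).2.2.1)
      (Z := fun k => inner ℝ (A.batchGrad (p k) (ζ k) - ∇ A.f (p k).1) (noiseDir xstar (p k)))
      (R := R) (w := w) hε.le (pow_le_pow_left₀ (norm_nonneg _) hR 2)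
      (fun k => sq_nonneg _) rfl (fun k => rfl)
      (fun k => sub_nonneg.2 (hmin (mem_univ _))) hh0
      (antitone_nat_of_succ_le fun k => one_div_le_one_div_of_le (hpL0 _)
        (track_L_le_succ hlo h0 ζ _)) (fun k hk => ?_) (fun j hj => ?_) ?_ ?_
    · have h1 : A.Accepts (p k).1 (A.batchGrad (p k) (ζ k)) (p (k + 1)).2.1 :=
        accepts_search (hacc k hk)
      refine (sq_norm_gradStep_le hf hd (hpL0 (k + 1)) h1 xstar).trans (le_of_eq ?_)
      rw [noiseDir, inner_smul_right, mul_inv_cancel_left₀ (Real.sqrt_pos.2 (hV0 k)).ne']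
    · have h1 : (p j).2.2.2 = ∑ k ∈ Finset.range j,
          inner ℝ (A.batchGrad (p k) (ζ k) - ∇ A.f (p k).1) (noiseDir xstar (p k)) := by
        clear hj
        induction j with
        | zero => rfl
        | succ j ih => rw [Finset.sum_range_succ, ← ih]; rfl
      rw [← h1]
      exact hW j hj
    · have hw0 : 0 ≤ w := (abs_nonneg _).trans (hW 0 A.N.zero_le)
      have h1 : h 0 * w ≤ 1 / A.Llo * w :=
        mul_le_mul_of_nonneg_right (one_div_le_one_div_of_le hlo (hpL 1).1) hw0
      have h2 : 1 / A.Llo * (16 * w) ≤ R := by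
        rw [one_div_mul_eq_div, div_le_iff₀ hlo]; linarith
      linarith
    · have h1 : A.N * (1 / A.Lhi) ≤ ∑ k ∈ Finset.range A.N, h k := by
        have := Finset.card_nsmul_le_sum (Finset.range A.N) h (1 / A.Lhi) fun k _ =>
          one_div_le_one_div_of_le (hpL0 (k + 1)) (hpL (k + 1)).2
        simpa using this
      have h2 : 4 * R ^ 2 = A.ε * (4 * (A.Lhi * R ^ 2 / A.ε) * (1 / A.Lhi)) := by field_simp
      rw [h2]
      refine mul_le_mul_of_nonneg_left (le_trans ?_ h1) hε.le
      exact mul_le_mul_of_nonneg_right hN (by positivity)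
  refine ⟨(∑ k ∈ Finset.range A.N, h k)⁻¹ • ∑ k ∈ Finset.range A.N, h k • (p (k + 1)).1, ?_, ?_⟩
  · have e1 : ∑ k ∈ Finset.range A.N, 1 / (A.stateAt ζ (k + 1)).L = ∑ k ∈ Finset.range A.N, h k :=
      Finset.sum_congr rfl fun k hk => by rw [hstate k (Finset.mem_range.1 hk)]
    have e2 : ∑ k ∈ Finset.range A.N, (1 / (A.stateAt ζ (k + 1)).L) • (A.stateAt ζ (k + 1)).x =
        ∑ k ∈ Finset.range A.N, h k • (p (k + 1)).1 :=
      Finset.sum_congr rfl fun k hk => by rw [hstate k (Finset.mem_range.1 hk)]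
    rw [output, hrun _ le_rfl, Option.map_some, e1, e2]
  · have hj := hf.map_centerMass_le (t := Finset.range A.N) (w := h) (p := fun k => (p (k + 1)).1)
      (fun k _ => (hh0 k).le) hH fun k _ => mem_univ _
    simp only [Finset.centerMass, smul_eq_mul, Function.comp_apply] at hj
    rw [inv_mul_eq_div, le_div_iff₀ hH] at hj
    simp only [mul_sub, Finset.sum_sub_distrib, ← Finset.sum_mul] at key
    refine le_of_mul_le_mul_right ?_ hH
    linarith

end AdaptiveSGD

end Descent

/-! ### Concentration -/

lemma measure_le_of_lintegral_exp_le {Ω : Type*} [MeasurableSpace Ω] {P : Measure Ω} {X : Ω → ℝ}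
    (hX : Measurable X) {c : ℝ}
    (h : ∫⁻ ω, ENNReal.ofReal (Real.exp (X ω)) ∂P ≤ ENNReal.ofReal (Real.exp c)) (t : ℝ) :
    P {ω | t ≤ X ω} ≤ ENNReal.ofReal (Real.exp (c - t)) := by
  have h1 := meas_ge_le_lintegral_div (μ := P) (f := fun ω => ENNReal.ofReal (Real.exp (X ω)))
    (by fun_prop) (ε := ENNReal.ofReal (Real.exp t)) (by simp [Real.exp_pos]) (by simp)
  have h2 : {ω | t ≤ X ω} ⊆ {ω | ENNReal.ofReal (Real.exp t) ≤ ENNReal.ofReal (Real.exp (X ω))} :=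
    fun ω hω => ENNReal.ofReal_le_ofReal (Real.exp_le_exp.2 hω)
  refine (measure_mono h2).trans (h1.trans ?_)
  rw [Real.exp_sub, ENNReal.ofReal_div_of_pos (Real.exp_pos _)]
  exact ENNReal.div_le_div_right h _

namespace IsLightTailedOracle

variable {E S : Type*} [NormedAddCommGroup E] [InnerProductSpace ℝ E] [CompleteSpace E]
  [MeasurableSpace E] [BorelSpace E] [SecondCountableTopology E] [MeasurableSpace S]
  {f : E → ℝ} {G : E → S → E} {ν : Measure S} {σ : ℝ}

omit [SecondCountableTopology E] in
lemma measurable_noise (h : IsLightTailedOracle f G ν σ) (x : E) :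
    Measurable fun s => G x s - ∇ f x :=
  (h.measurable.comp measurable_prodMk_left).sub_const _

lemma expMomentLE (h : IsLightTailedOracle f G ν σ) (x : E) :
    ExpMomentLE ν (fun s => ‖G x s - ∇ f x‖ ^ 2 / σ ^ 2) 1 := by
  have hm := h.measurable_noise x
  have hi : Integrable (fun s => Real.exp (‖G x s - ∇ f x‖ ^ 2 / σ ^ 2)) ν := by
    refine (lintegral_ofReal_ne_top_iff_integrable (Measurable.aestronglyMeasurable (by fun_prop))
      (ae_of_all _ fun s => (Real.exp_pos _).le)).1 ?_
    exact ((h.light_tailed x).trans_lt ENNReal.ofReal_lt_top).ne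
  refine ⟨_, hi, fun s => le_rfl, ?_⟩
  refine (ENNReal.ofReal_le_ofReal_iff (Real.exp_pos _).le).1 ?_
  rw [ofReal_integral_eq_lintegral_ofReal hi (ae_of_all _ fun s => (Real.exp_pos _).le)]
  exact h.light_tailed x

variable [IsProbabilityMeasure ν]

omit [BorelSpace E] [SecondCountableTopology E] in
lemma integrable_noise (h : IsLightTailedOracle f G ν σ) (x : E) :
    Integrable (fun s => G x s - ∇ f x) ν :=
  (h.integrable x).sub (integrable_const _)

omit [BorelSpace E] [SecondCountableTopology E] in
lemma integral_noise (h : IsLightTailedOracle f G ν σ) (x : E) :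
    ∫ s, (G x s - ∇ f x) ∂ν = 0 := by
  rw [integral_sub (h.integrable x) (integrable_const _), h.unbiased]
  simp

end IsLightTailedOracle

namespace AdaptiveSGD

variable {E S : Type*} [NormedAddCommGroup E] [InnerProductSpace ℝ E] [CompleteSpace E]
  {A : AdaptiveSGD E S} {m : ℕ} {xstar : E} {R : ℝ}

omit [CompleteSpace E] in
lemma miniBatch_sub {r : ℕ} (hr : 1 ≤ r) (x c : E) (s : ℕ → S) :
    A.miniBatch x r s - c = (1 / (r : ℝ)) • ∑ l ∈ Finset.range r, (A.G x (s l) - c) := by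
  have hr0 : (r : ℝ) ≠ 0 := by positivity
  rw [miniBatch, Finset.sum_sub_distrib, smul_sub, Finset.sum_const, Finset.card_range,
    ← Nat.cast_smul_eq_nsmul ℝ, smul_smul, one_div_mul_cancel hr0, one_smul]

variable [MeasurableSpace E] [BorelSpace E] [SecondCountableTopology E] [MeasurableSpace S]
  {ν : Measure S} [IsProbabilityMeasure ν] {Ω : Type*} [MeasurableSpace Ω] {P : Measure Ω}
  [IsProbabilityMeasure P] {σ : ℝ}

lemma lintegral_exp_inner_batch_noise_le (hG : IsLightTailedOracle A.f A.G ν σ) (hσ : 0 < σ)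
    {η : ℕ → Ω → S} (hη : ∀ l, Measurable (η l)) (hmap : ∀ l, P.map (η l) = ν)
    (hind : iIndepFun η P) (p : E × ℝ × ℝ × ℝ) (v : E) (a : ℝ) :
    ∫⁻ ω, ENNReal.ofReal (Real.exp
        (a + inner ℝ (A.batchGrad p (fun l => η l ω) - ∇ A.f p.1) v)) ∂P ≤
      ENNReal.ofReal (Real.exp (a + σ ^ 2 * ‖v‖ ^ 2 / A.batchSize p.2.1)) := by
  have hr := A.one_le_batchSize p.2.1
  set r := A.batchSize p.2.1 with hr_def
  have hr0 : (0 : ℝ) < r := by positivity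
  have h := lintegral_exp_inner_sum_le hσ hη hmap hind (hG.measurable_noise p.1)
    (hG.integrable_noise p.1) (hG.integral_noise p.1) (hG.expMomentLE p.1) ((1 / (r : ℝ)) • v) a r
  simp only [batchGrad, ← hr_def, miniBatch_sub hr, inner_smul_left]
  simp only [inner_smul_right] at h
  refine h.trans (le_of_eq ?_)
  rw [norm_smul, Real.norm_of_nonneg (by positivity)]
  congr 3
  field_simp

lemma lintegral_exp_sq_norm_batch_noise_le (hG : IsLightTailedOracle A.f A.G ν σ) (hσ : 0 < σ)
    {η : ℕ → Ω → S} (hη : ∀ l, Measurable (η l)) (hmap : ∀ l, P.map (η l) = ν)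
    (hind : iIndepFun η P) (p : E × ℝ × ℝ × ℝ) :
    ∫⁻ ω, ENNReal.ofReal (Real.exp (A.batchSize p.2.1 / (16 * σ ^ 2) *
        ‖A.batchGrad p (fun l => η l ω) - ∇ A.f p.1‖ ^ 2)) ∂P ≤
      ENNReal.ofReal (Real.exp (1 / 8)) := by
  have hr := A.one_le_batchSize p.2.1
  set r := A.batchSize p.2.1 with hr_def
  have hr0 : (0 : ℝ) < r := by positivity
  have h := lintegral_exp_sq_norm_sum_le hσ hη hmap hind (hG.measurable_noise p.1)
    (hG.integrable_noise p.1) (hG.integral_noise p.1) (hG.expMomentLE p.1) hr 0 r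
  convert h using 5 with ω
  · rw [batchGrad, ← hr_def, miniBatch_sub hr, norm_smul, Real.norm_of_nonneg (by positivity)]
    field_simp
    ring
  · field_simp
    ring

/-! ### Tail bounds for the noise along the run -/

section Samples

variable {ξ : ℕ → ℕ → Ω → S}

omit [IsProbabilityMeasure ν] in
-- The state before iteration `k` is independent of the samples of row `k`, so these may be replaced
-- by an independent copy, indexed by `ω'`. This plays the role of conditioning on the past.
lemma lintegral_track_eq (hf : Continuous A.f) (hf' : Continuous (∇ A.f))
    (hG : IsLightTailedOracle A.f A.G ν σ) (hξ : ∀ k l, Measurable (ξ k l))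
    (hind : iIndepFun (fun p : ℕ × ℕ => ξ p.1 p.2) P) (k : ℕ)
    {F : (E × ℝ × ℝ × ℝ) × (ℕ → S) → ENNReal} (hF : Measurable F) :
    ∫⁻ ω, F (A.track m xstar R (fun k l => ξ k l ω) k, fun l => ξ k l ω) ∂P =
      ∫⁻ ω, ∫⁻ ω', F (A.track m xstar R (fun k l => ξ k l ω) k, fun l => ξ k l ω') ∂P ∂P := by
  have hX := measurable_track (A := A) (m := m) (xstar := xstar) (R := R) (ξ := ξ) hf hf'
    hG.measurable k
  have hY : Measurable[sigmaOf (fun p : ℕ × ℕ => ξ p.1 p.2) {p | p.1 = k}] fun ω l => ξ k l ω :=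
    @measurable_pi_lambda _ _ _ (sigmaOf _ _) _ _ fun l =>
      measurable_sigmaOf (i := (k, l)) (ξ := fun p : ℕ × ℕ => ξ p.1 p.2) rfl
  have hdisj : Disjoint {p : ℕ × ℕ | p.1 < k} {p | p.1 = k} :=
    Set.disjoint_left.2 fun p h1 h2 => (ne_of_lt h1) h2
  have hξ' : ∀ p : ℕ × ℕ, Measurable (ξ p.1 p.2) := fun p => hξ p.1 p.2
  have hYm : Measurable fun ω l => ξ k l ω := measurable_pi_lambda _ fun l => hξ k l
  rw [lintegral_comp_eq_of_indepFun (hX.mono (sigmaOf_le hξ' _) le_rfl) hYm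
    (indepFun_of_measurable_sigmaOf hξ' hind hdisj hX hY) hF]
  refine lintegral_congr fun ω => ?_
  exact lintegral_map (hF.comp measurable_prodMk_left) hYm

omit [IsProbabilityMeasure P] in
lemma iIndepFun_row (hind : iIndepFun (fun p : ℕ × ℕ => ξ p.1 p.2) P) (k : ℕ) :
    iIndepFun (ξ k) P :=
  hind.precomp (g := fun l => (k, l)) fun _ _ h => (Prod.ext_iff.1 h).2

lemma measurable_noise_batch (hf' : Continuous (∇ A.f))
    (hG : Measurable fun p : E × S => A.G p.1 p.2) :
    Measurable fun q : (E × ℝ × ℝ × ℝ) × (ℕ → S) => A.batchGrad q.1 q.2 - ∇ A.f q.1.1 := by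
  have h1 := measurable_batchGrad hG
  have h2 := hf'.measurable
  fun_prop

lemma lintegral_exp_track_W_le (hf : Continuous A.f) (hf' : Continuous (∇ A.f))
    (hG : IsLightTailedOracle A.f A.G ν σ) (hσ : 0 < σ) (hξ : ∀ k l, Measurable (ξ k l))
    (hmap : ∀ k l, P.map (ξ k l) = ν) (hind : iIndepFun (fun p : ℕ × ℕ => ξ p.1 p.2) P)
    (hR : ‖A.x₀ - xstar‖ ≤ R) (hlo : 0 < A.Llo) (h0 : A.L₀ ∈ Icc A.Llo A.Lhi) {ρ : ℝ} (hρ : 0 < ρ)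
    (hbatch : ∀ L ∈ Icc A.Llo A.Lhi, ρ ≤ A.batchSize L) (c : ℝ) (j : ℕ) :
    ∫⁻ ω, ENNReal.ofReal (Real.exp (c * (A.track m xstar R (fun k l => ξ k l ω) j).2.2.2)) ∂P ≤
      ENNReal.ofReal (Real.exp (j * (c ^ 2 * σ ^ 2 / ρ))) := by
  induction j with
  | zero => simp [track]
  | succ j ih =>
    have hn := measurable_noise_batch hf' hG.measurable
    have hd := measurable_noiseDir xstar
    have hF : Measurable fun q : (E × ℝ × ℝ × ℝ) × (ℕ → S) => ENNReal.ofReal (Real.exp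
        (c * q.1.2.2.2 + inner ℝ (A.batchGrad q.1 q.2 - ∇ A.f q.1.1) (c • noiseDir xstar q.1))) := by
      fun_prop
    calc _ = ∫⁻ ω, ENNReal.ofReal (Real.exp
          (c * (A.track m xstar R (fun k l => ξ k l ω) j).2.2.2 +
            inner ℝ (A.batchGrad (A.track m xstar R (fun k l => ξ k l ω) j) (fun l => ξ j l ω) -
              ∇ A.f (A.track m xstar R (fun k l => ξ k l ω) j).1)
              (c • noiseDir xstar (A.track m xstar R (fun k l => ξ k l ω) j)))) ∂P := by
          refine lintegral_congr fun ω => ?_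
          rw [inner_smul_right, ← mul_add]
          rfl
      _ ≤ ∫⁻ ω, ENNReal.ofReal (Real.exp (c ^ 2 * σ ^ 2 / ρ)) * ENNReal.ofReal (Real.exp
          (c * (A.track m xstar R (fun k l => ξ k l ω) j).2.2.2)) ∂P := by
          rw [lintegral_track_eq hf hf' hG hξ hind j hF]
          refine lintegral_mono fun ω => (lintegral_exp_inner_batch_noise_le hG hσ (hξ j) (hmap j)
            (iIndepFun_row hind j) (A.track m xstar R (fun k l => ξ k l ω) j)
            (c • noiseDir xstar (A.track m xstar R (fun k l => ξ k l ω) j))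
            (c * (A.track m xstar R (fun k l => ξ k l ω) j).2.2.2)).trans ?_
          rw [← ENNReal.ofReal_mul (Real.exp_pos _).le, ← Real.exp_add, add_comm]
          refine ENNReal.ofReal_le_ofReal (Real.exp_le_exp.2 (add_le_add ?_ le_rfl))
          have h1 : ‖c • noiseDir xstar (A.track m xstar R (fun k l => ξ k l ω) j)‖ ^ 2 ≤ c ^ 2 := by
            rw [norm_smul, mul_pow, Real.norm_eq_abs, sq_abs]
            refine mul_le_of_le_one_right (sq_nonneg c) (pow_le_one₀ (norm_nonneg _) ?_)
            exact norm_noiseDir_track_le hR _ j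
          rw [mul_comm (c ^ 2)]
          gcongr
          exact hbatch _ (track_L_mem hlo h0 _ j)
      _ ≤ _ := by
          rw [lintegral_const_mul' _ _ ENNReal.ofReal_ne_top]
          refine (mul_le_mul_right ih _).trans (le_of_eq ?_)
          rw [← ENNReal.ofReal_mul (Real.exp_pos _).le, ← Real.exp_add]
          congr 2; push_cast; ring

omit [IsProbabilityMeasure ν] in
lemma measurable_track' (hf : Continuous A.f) (hf' : Continuous (∇ A.f))
    (hG : IsLightTailedOracle A.f A.G ν σ) (hξ : ∀ k l, Measurable (ξ k l)) (k : ℕ) :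
    Measurable fun ω => A.track m xstar R (fun k l => ξ k l ω) k :=
  (measurable_track hf hf' hG.measurable k).mono
    (sigmaOf_le (ξ := fun p : ℕ × ℕ => ξ p.1 p.2) (fun p => hξ p.1 p.2) _) le_rfl

lemma measure_abs_track_W_gt_le (hf : Continuous A.f) (hf' : Continuous (∇ A.f))
    (hG : IsLightTailedOracle A.f A.G ν σ) (hσ : 0 < σ) (hξ : ∀ k l, Measurable (ξ k l))
    (hmap : ∀ k l, P.map (ξ k l) = ν) (hind : iIndepFun (fun p : ℕ × ℕ => ξ p.1 p.2) P)
    (hR : ‖A.x₀ - xstar‖ ≤ R) (hlo : 0 < A.Llo) (h0 : A.L₀ ∈ Icc A.Llo A.Lhi) {ρ : ℝ} (hρ : 0 < ρ)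
    (hbatch : ∀ L ∈ Icc A.Llo A.Lhi, ρ ≤ A.batchSize L) {w : ℝ} (hw : 0 ≤ w) {j n : ℕ} (hj : j ≤ n)
    (hn : 0 < n) :
    P {ω | w < |(A.track m xstar R (fun k l => ξ k l ω) j).2.2.2|} ≤
      ENNReal.ofReal (2 * Real.exp (-(w ^ 2 * ρ / (4 * n * σ ^ 2)))) := by
  -- The value of `c` below minimizes the Chernoff exponent `n * c ^ 2 * σ ^ 2 / ρ - c * w`; the
  -- signs `c` and `-c` treat the two tails.
  have hn0 : (0 : ℝ) < n := by exact_mod_cast hn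
  set c := w * ρ / (2 * n * σ ^ 2) with hc
  have hc0 : 0 ≤ c := by positivity
  have hWm : Measurable fun ω => (A.track m xstar R (fun k l => ξ k l ω) j).2.2.2 := by
    have := measurable_track' (m := m) (xstar := xstar) (R := R) hf hf' hG hξ j
    fun_prop
  have hexp : ∀ c', c' ^ 2 = c ^ 2 →
      P {ω | c * w ≤ c' * (A.track m xstar R (fun k l => ξ k l ω) j).2.2.2} ≤
        ENNReal.ofReal (Real.exp (-(w ^ 2 * ρ / (4 * n * σ ^ 2)))) := fun c' hc' => by
    refine (measure_le_of_lintegral_exp_le (hWm.const_mul c') (lintegral_exp_track_W_le hf hf' hG hσ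
      hξ hmap hind hR hlo h0 hρ hbatch c' j) _).trans
      (ENNReal.ofReal_le_ofReal (Real.exp_le_exp.2 ?_))
    have h1 : (j : ℝ) * (c ^ 2 * σ ^ 2 / ρ) ≤ n * (c ^ 2 * σ ^ 2 / ρ) := by gcongr
    have h2 : n * (c ^ 2 * σ ^ 2 / ρ) - c * w = -(w ^ 2 * ρ / (4 * n * σ ^ 2)) := by
      rw [hc]; field_simp; ring
    rw [hc']
    linarith
  calc _ ≤ P ({ω | c * w ≤ c * (A.track m xstar R (fun k l => ξ k l ω) j).2.2.2} ∪
        {ω | c * w ≤ -c * (A.track m xstar R (fun k l => ξ k l ω) j).2.2.2}) := by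
        refine measure_mono fun ω (hω : w < |_|) => ?_
        rcases lt_abs.1 hω with h | h
        · exact Or.inl (mul_le_mul_of_nonneg_left h.le hc0)
        · refine Or.inr ?_
          rw [mem_ofPred_eq, neg_mul_comm]
          exact mul_le_mul_of_nonneg_left h.le hc0
    _ ≤ _ := measure_union_le _ _
    _ ≤ _ := add_le_add (hexp c rfl) (hexp (-c) (neg_sq c))
    _ = _ := by
        rw [← ENNReal.ofReal_add (Real.exp_pos _).le (Real.exp_pos _).le]
        congr 1; ring

lemma measure_sq_norm_batch_noise_gt_le (hf : Continuous A.f) (hf' : Continuous (∇ A.f))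
    (hG : IsLightTailedOracle A.f A.G ν σ) (hσ : 0 < σ) (hξ : ∀ k l, Measurable (ξ k l))
    (hmap : ∀ k l, P.map (ξ k l) = ν) (hind : iIndepFun (fun p : ℕ × ℕ => ξ p.1 p.2) P)
    (hlo : 0 < A.Llo) (h0 : A.L₀ ∈ Icc A.Llo A.Lhi) {ρ : ℝ}
    (hbatch : ∀ L ∈ Icc A.Llo A.Lhi, ρ ≤ A.batchSize L) {t : ℝ} (ht : 0 ≤ t) (k : ℕ) :
    P {ω | t < ‖A.batchGrad (A.track m xstar R (fun k l => ξ k l ω) k) (fun l => ξ k l ω) -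
        ∇ A.f (A.track m xstar R (fun k l => ξ k l ω) k).1‖ ^ 2} ≤
      ENNReal.ofReal (Real.exp (1 / 8 - ρ * t / (16 * σ ^ 2))) := by
  have hn := measurable_noise_batch hf' hG.measurable
  have hb := measurable_batchSize A
  have hb' : Measurable fun q : (E × ℝ × ℝ × ℝ) × (ℕ → S) => (A.batchSize q.1.2.1 : ℝ) :=
    measurable_from_top.comp (hb.comp (measurable_fst.comp (measurable_snd.comp measurable_fst)))
  have hX : Measurable fun q : (E × ℝ × ℝ × ℝ) × (ℕ → S) =>
      A.batchSize q.1.2.1 / (16 * σ ^ 2) * ‖A.batchGrad q.1 q.2 - ∇ A.f q.1.1‖ ^ 2 :=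
    (hb'.div_const _).mul (hn.norm.pow_const 2)
  have hT := measurable_track' (A := A) (m := m) (xstar := xstar) (R := R) hf hf' hG hξ k
  have hYm : Measurable fun ω l => ξ k l ω := measurable_pi_lambda _ fun l => hξ k l
  have hXm := hX.comp (hT.prodMk hYm)
  refine (measure_mono fun ω (hω : t < _) => ?_).trans (measure_le_of_lintegral_exp_le hXm ?_ _)
  · change ρ * t / (16 * σ ^ 2) ≤ _ / (16 * σ ^ 2) * _
    have h1 := hbatch _ (track_L_mem (m := m) (xstar := xstar) (R := R) hlo h0
      (fun k l => ξ k l ω) k)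
    rw [div_mul_eq_mul_div]
    gcongr
  · have h1 := lintegral_track_eq (A := A) (m := m) (xstar := xstar) (R := R) hf hf' hG hξ hind k
      (F := fun q => ENNReal.ofReal (Real.exp (A.batchSize q.1.2.1 / (16 * σ ^ 2) *
        ‖A.batchGrad q.1 q.2 - ∇ A.f q.1.1‖ ^ 2)))
      (ENNReal.measurable_ofReal.comp (Real.measurable_exp.comp hX))
    refine (le_of_eq h1).trans ?_
    calc _ ≤ ∫⁻ _, ENNReal.ofReal (Real.exp (1 / 8)) ∂P := lintegral_mono fun ω =>
          lintegral_exp_sq_norm_batch_noise_le hG hσ (hξ k) (hmap k) (iIndepFun_row hind k) _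
      _ = _ := by simp

/-- With probability at least `1 - δ`, the noise of every mini-batch is small, and so are all
partial sums of its components along the directions `noiseDir`. -/
lemma ofReal_one_sub_le_measure_track (hf : Continuous A.f) (hf' : Continuous (∇ A.f))
    (hG : IsLightTailedOracle A.f A.G ν σ) (hσ : 0 < σ) (hξ : ∀ k l, Measurable (ξ k l))
    (hmap : ∀ k l, P.map (ξ k l) = ν) (hind : iIndepFun (fun p : ℕ × ℕ => ξ p.1 p.2) P)
    (hR : ‖A.x₀ - xstar‖ ≤ R) (hlo : 0 < A.Llo) (h0 : A.L₀ ∈ Icc A.Llo A.Lhi) {ρ : ℝ} (hρ : 0 < ρ)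
    (hbatch : ∀ L ∈ Icc A.Llo A.Lhi, ρ ≤ A.batchSize L) {w t δ : ℝ} (hw : 0 ≤ w) (ht : 0 ≤ t)
    (hN : 0 < A.N) (hδ : A.N * Real.exp (1 / 8 - ρ * t / (16 * σ ^ 2)) +
      (A.N + 1) * (2 * Real.exp (-(w ^ 2 * ρ / (4 * A.N * σ ^ 2)))) ≤ δ) :
    ENNReal.ofReal (1 - δ) ≤ P {ω |
      (∀ k < A.N, ‖A.batchGrad (A.track m xstar R (fun k l => ξ k l ω) k) (fun l => ξ k l ω) -
        ∇ A.f (A.track m xstar R (fun k l => ξ k l ω) k).1‖ ^ 2 ≤ t) ∧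
      ∀ j ≤ A.N, |(A.track m xstar R (fun k l => ξ k l ω) j).2.2.2| ≤ w} := by
  set good := {ω |
      (∀ k < A.N, ‖A.batchGrad (A.track m xstar R (fun k l => ξ k l ω) k) (fun l => ξ k l ω) -
        ∇ A.f (A.track m xstar R (fun k l => ξ k l ω) k).1‖ ^ 2 ≤ t) ∧
      ∀ j ≤ A.N, |(A.track m xstar R (fun k l => ξ k l ω) j).2.2.2| ≤ w}
  set bad₁ : ℕ → Set Ω := fun k =>
    {ω | t < ‖A.batchGrad (A.track m xstar R (fun k l => ξ k l ω) k) (fun l => ξ k l ω) -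
        ∇ A.f (A.track m xstar R (fun k l => ξ k l ω) k).1‖ ^ 2}
  set bad₂ : ℕ → Set Ω := fun j =>
    {ω | w < |(A.track m xstar R (fun k l => ξ k l ω) j).2.2.2|}
  have hcover : (univ : Set Ω) ⊆ good ∪
      ((⋃ k ∈ Finset.range A.N, bad₁ k) ∪ ⋃ j ∈ Finset.range (A.N + 1), bad₂ j) := fun ω _ => by
    by_contra hω
    simp only [mem_union, mem_iUnion, not_or, not_exists, Finset.mem_range] at hω
    exact hω.1 ⟨fun k hk => not_lt.1 (hω.2.1 k hk),
      fun j hj => not_lt.1 (hω.2.2 j (Nat.lt_succ_of_le hj))⟩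
  have h1 : P (⋃ k ∈ Finset.range A.N, bad₁ k) ≤
      ENNReal.ofReal (A.N * Real.exp (1 / 8 - ρ * t / (16 * σ ^ 2))) := by
    refine (measure_biUnion_finset_le _ _).trans ((Finset.sum_le_card_nsmul _ _ _ fun k _ =>
      measure_sq_norm_batch_noise_gt_le hf hf' hG hσ hξ hmap hind hlo h0 hbatch ht k).trans ?_)
    rw [Finset.card_range, nsmul_eq_mul, ENNReal.ofReal_mul (by positivity), ENNReal.ofReal_natCast]
  have h2 : P (⋃ j ∈ Finset.range (A.N + 1), bad₂ j) ≤
      ENNReal.ofReal ((A.N + 1) * (2 * Real.exp (-(w ^ 2 * ρ / (4 * A.N * σ ^ 2))))) := by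
    refine (measure_biUnion_finset_le _ _).trans ((Finset.sum_le_card_nsmul _ _ _ fun j hj =>
      measure_abs_track_W_gt_le hf hf' hG hσ hξ hmap hind hR hlo h0 hρ hbatch hw
        (Nat.lt_succ_iff.1 (Finset.mem_range.1 hj)) hN).trans ?_)
    rw [Finset.card_range, nsmul_eq_mul, ENNReal.ofReal_mul (by positivity : (0 : ℝ) ≤ A.N + 1),
      ← Nat.cast_succ, ENNReal.ofReal_natCast]
  have hδ0 : 0 ≤ δ := le_trans (by positivity) hδ
  rw [ENNReal.ofReal_sub _ hδ0, ENNReal.ofReal_one, tsub_le_iff_right]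
  calc (1 : ENNReal) = P univ := measure_univ.symm
    _ ≤ P (good ∪ ((⋃ k ∈ Finset.range A.N, bad₁ k) ∪ ⋃ j ∈ Finset.range (A.N + 1), bad₂ j)) :=
        measure_mono hcover
    _ ≤ P good + (P (⋃ k ∈ Finset.range A.N, bad₁ k) + P (⋃ j ∈ Finset.range (A.N + 1), bad₂ j)) :=
        (measure_union_le _ _).trans (add_le_add le_rfl (measure_union_le _ _))
    _ ≤ P good + ENNReal.ofReal δ := by
        refine add_le_add le_rfl ((add_le_add h1 h2).trans ?_)
        rw [← ENNReal.ofReal_add (by positivity) (by positivity)]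
        exact ENNReal.ofReal_le_ofReal hδ

end Samples

end AdaptiveSGD

/-! ### Union bound and choice of the constants -/

/-- With `q = exp (-Λ)` one has `N * q ≤ α` and `q ≤ 1 / 2`, so `N * q ^ 4 ≤ α / 8`; the left side
is at most `6 * N * q ^ 4`. -/
lemma union_bound_le {N α Λ a : ℝ} (hN : 2 ≤ N) (hα : α < 1) (hΛ : Real.exp (-Λ) ≤ α / N)
    (ha : 4 * Λ ≤ a) :
    N * Real.exp (1 / 8 - a) + (N + 1) * (2 * Real.exp (-(4 * Λ))) ≤ α := by
  have h1 : Real.exp (1 / 8 - a) ≤ 2 * Real.exp (-(4 * Λ)) := by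
    calc _ ≤ Real.exp (Real.log 2 + -(4 * Λ)) := by
          refine Real.exp_le_exp.2 ?_
          linarith [Real.log_two_gt_d9]
      _ = _ := by rw [Real.exp_add, Real.exp_log two_pos]
  have h2 : Real.exp (-(4 * Λ)) = Real.exp (-Λ) ^ 4 := by
    rw [← Real.exp_nat_mul]; congr 1; push_cast; ring
  rw [h2] at h1 ⊢
  have hq0 : 0 < Real.exp (-Λ) := Real.exp_pos _
  generalize Real.exp (-Λ) = q at *
  have hNq : N * q ≤ α := by
    rw [le_div_iff₀ (by linarith)] at hΛ
    linarith
  have hq2 : q ≤ 1 / 2 := by linarith [mul_le_mul_of_nonneg_right hN hq0.le]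
  have hq3 : q ^ 3 ≤ 1 / 8 := by
    calc q ^ 3 ≤ (1 / 2) ^ 3 := by gcongr
      _ = 1 / 8 := by norm_num
  have h3 : N * q ^ 4 ≤ α / 8 := by
    calc N * q ^ 4 = N * q * q ^ 3 := by ring
      _ ≤ α * (1 / 8) := by
        have : 0 ≤ α := le_trans (by positivity) hNq
        gcongr
      _ = _ := by ring
  have h4 : q ^ 4 ≤ N * q ^ 4 := le_mul_of_one_le_left (by positivity) (by linarith)
  have h5 := mul_le_mul_of_nonneg_left h1 (by linarith : 0 ≤ N)
  have h6 : 0 ≤ q ^ 4 := by positivity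
  linarith

theorem theorem2 :
    ∃ c₀ : ℝ, 0 < c₀ ∧ ∀ c₁ : ℝ, c₀ ≤ c₁ →
    ∃ κ₀ : ℝ, 0 < κ₀ ∧ ∀ κ : ℝ, κ₀ ≤ κ →
    ∃ K : ℝ, 0 < K ∧
    ∀ (n : ℕ) (S : Type*) [MeasurableSpace S] (ν : Measure S) [IsProbabilityMeasure ν]
      (Ω : Type*) [MeasurableSpace Ω] (P : Measure Ω) [IsProbabilityMeasure P]
      (A : AdaptiveSGD (EuclideanSpace ℝ (Fin n)) S)
      (ξ : ℕ → ℕ → Ω → S) (xstar : EuclideanSpace ℝ (Fin n)) (R L σ : ℝ) (m : ℕ),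
      A.κ = κ →
      -- the objective
      ConvexOn ℝ univ A.f →
      HasLipschitzGradient A.f L →
      IsMinOn A.f univ xstar →
      ‖A.x₀ - xstar‖ ≤ R →
      -- the parameters
      0 < A.Llo → A.Llo ≤ L → L ≤ A.Lhi →
      A.Llo ≤ A.L₀ → A.L₀ ≤ A.Lhi →
      Real.logb 2 (A.Lhi / A.Llo) = m → 1 ≤ m →
      0 < A.ε → 0 < A.α → A.α < 1 →
      -- the stochastic oracle and the independent samples
      0 < σ → σ ≤ A.σ₀ →
      IsLightTailedOracle A.f A.G ν σ →
      (∀ k l, Measurable (ξ k l)) →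
      (∀ k l, P.map (ξ k l) = ν) →
      iIndepFun (fun p : ℕ × ℕ => ξ p.1 p.2) P →
      -- the number of iterations
      2 ≤ A.N →
      c₀ * (A.Lhi * R ^ 2 / A.ε) ≤ A.N →
      A.N ≤ c₁ * (A.Lhi * R ^ 2 / A.ε) →
      -- the number of oracle calls
      (∀ ω, (A.oracleCalls (fun k l => ξ k l ω) : ℝ) ≤
          A.N + K * A.logFactor * (A.σ₀ ^ 2 * R ^ 2 * A.Lhi ^ 3 / (A.ε ^ 2 * A.Llo ^ 3))) ∧
      (1 ≤ κ * A.batchScale A.Lhi → ∀ ω, (A.oracleCalls (fun k l => ξ k l ω) : ℝ) ≤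
          K * A.logFactor * (A.σ₀ ^ 2 * R ^ 2 * A.Lhi ^ 3 / (A.ε ^ 2 * A.Llo ^ 3))) ∧
      -- the accuracy of the output
      ENNReal.ofReal (1 - A.α) ≤
        P {ω | ∃ xbar, A.output (fun k l => ξ k l ω) = some xbar ∧
          A.f xbar - A.f xstar ≤ A.ε} := by
  -- The value 4 is what the recursion needs. The factor `4096 = 16 ^ 2 * 16` comes from `16 * w ≤
  -- Llo * R` with `w ^ 2 = 16 * N * σ ^ 2 * Λ / ρ`. In `2 * κ * c₁` the factor 2 absorbs the
  -- summand `N` in the second bound on the oracle calls.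
  refine ⟨4, by norm_num, fun c₁ hc₁ => ⟨4096 * c₁, by linarith, fun κ hκ => ⟨2 * κ * c₁,
    mul_pos (mul_pos two_pos (by linarith)) (by linarith), ?_⟩⟩⟩
  intro n S _ ν _ Ω _ P _ A ξ xstar R L σ m hAκ hconv hlip hmin hR hlo hloL hLhi hL₀ hL₀' hm hm1 hε hα
    hα1 hσ hσ₀ hG hξ hmap hind hN2 hN hN'
  have hc₁0 : 0 < c₁ := by linarith
  have hκ0 : 0 < κ := by linarith
  have hlohi : A.Llo ≤ A.Lhi := hloL.trans hLhi
  have hhi : 0 < A.Lhi := hlo.trans_le hlohi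
  have hNr : (2 : ℝ) ≤ A.N := by exact_mod_cast hN2
  have hR0 : 0 < R := by
    -- If `R = 0`, the upper bound on `N` would contradict `2 ≤ N`.
    refine lt_of_le_of_ne ((norm_nonneg _).trans hR) fun h => ?_
    rw [← h] at hN'
    norm_num at hN'
    omega
  -- As `m ≥ 1`, `Λ` is at least `ln (N / α)`, which is all that the union bound requires.
  have hΛ : Real.log A.α⁻¹ + Real.log A.N ≤ A.logFactor := by
    have h1 : (1 : ℝ) ≤ m := by exact_mod_cast hm1
    have h2 : 0 ≤ Real.log A.N := Real.log_nonneg (by linarith)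
    rw [AdaptiveSGD.logFactor, hm]
    linarith [le_mul_of_one_le_left h2 h1]
  have hexpΛ : Real.exp (-A.logFactor) ≤ A.α / A.N := by
    refine (Real.exp_le_exp.2 (neg_le_neg hΛ)).trans (le_of_eq ?_)
    rw [Real.log_inv, neg_add, neg_neg, Real.exp_add, Real.exp_log hα, Real.exp_neg,
      Real.exp_log (by linarith), div_eq_mul_inv]
  have hΛ0 : 0 < A.logFactor := by
    have h1 : 0 < Real.log A.N := Real.log_pos (by linarith)
    have h2 : 0 < Real.log A.α⁻¹ := Real.log_pos ((one_lt_inv₀ hα).2 hα1)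
    linarith
  have hσ₀0 : 0 < A.σ₀ := hσ.trans_le hσ₀
  have hmem : A.L₀ ∈ Icc A.Llo A.Lhi := ⟨hL₀, hL₀'⟩
  have hcalls := fun ζ => AdaptiveSGD.oracleCalls_le (A := A) (hAκ ▸ hκ0.le) hΛ0.le hε hlo hmem ζ
  rw [hAκ] at hcalls
  have hNB : A.N * (κ * A.batchScale A.Llo) ≤
      κ * c₁ * A.logFactor * (A.σ₀ ^ 2 * R ^ 2 * A.Lhi ^ 3 / (A.ε ^ 2 * A.Llo ^ 3)) := by
    have h1 : 0 ≤ κ * A.batchScale A.Llo := by unfold AdaptiveSGD.batchScale; positivity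
    refine (mul_le_mul_of_nonneg_right hN' h1).trans (le_of_eq ?_)
    unfold AdaptiveSGD.batchScale
    field_simp
  have hT0 : 0 ≤ κ * c₁ * A.logFactor *
      (A.σ₀ ^ 2 * R ^ 2 * A.Lhi ^ 3 / (A.ε ^ 2 * A.Llo ^ 3)) := by positivity
  refine ⟨fun ω => ?_, fun hB ω => ?_, ?_⟩
  · have := hcalls fun k l => ξ k l ω
    linarith
  · have h1 := hcalls fun k l => ξ k l ω
    have h2 : 1 ≤ κ * A.batchScale A.Llo :=
      hB.trans (mul_le_mul_of_nonneg_left (AdaptiveSGD.batchScale_anti hΛ0.le hε hlo hlo hlohi)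
        hκ0.le)
    have h3 : (A.N : ℝ) * 1 ≤ A.N * (κ * A.batchScale A.Llo) := by gcongr
    linarith
  have hd : Differentiable ℝ A.f := hlip.1.differentiable (by norm_num)
  have hgrad : Continuous (∇ A.f) :=
    (InnerProductSpace.toDual ℝ _).symm.continuous.comp (hlip.1.continuous_fderiv (by norm_num))
  set ρ := κ * A.batchScale A.Lhi with hρ_def
  have hρ : ρ = κ * (A.σ₀ ^ 2 * A.Lhi * A.logFactor) / (A.ε * A.Llo ^ 2) := by
    rw [hρ_def, AdaptiveSGD.batchScale]; field_simp
  have hρ0 : 0 < ρ := by rw [hρ]; positivity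
  have hbatch : ∀ L ∈ Icc A.Llo A.Lhi, ρ ≤ A.batchSize L := fun L hL => by
    refine le_trans ?_ (A.le_batchSize L)
    rw [hAκ]
    exact mul_le_mul_of_nonneg_left
      (AdaptiveSGD.batchScale_anti hΛ0.le hε hlo (hlo.trans_le hL.1) hL.2) hκ0.le
  have hσsq : σ ^ 2 ≤ A.σ₀ ^ 2 := by gcongr
  -- Chosen so that the tail exponent `w ^ 2 * ρ / (4 * N * σ ^ 2)` equals `4 * Λ`.
  set w := √(16 * A.N * σ ^ 2 * A.logFactor / ρ) with hw_def
  have hwsq : w ^ 2 = 16 * A.N * σ ^ 2 * A.logFactor / ρ := Real.sq_sqrt (by positivity)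
  have hw : 16 * w ≤ A.Llo * R := by
    refine (pow_le_pow_iff_left₀ (by positivity) (by positivity) two_ne_zero).1 ?_
    have h1 : 16 * A.N * σ ^ 2 * A.logFactor / ρ ≤
        16 * (c₁ * (A.Lhi * R ^ 2 / A.ε)) * A.σ₀ ^ 2 * A.logFactor / ρ := by gcongr
    have h2 : 16 * (c₁ * (A.Lhi * R ^ 2 / A.ε)) * A.σ₀ ^ 2 * A.logFactor / ρ =
        16 * c₁ / κ * (A.Llo * R) ^ 2 := by
      rw [hρ]; field_simp
    have h3 : 16 * c₁ / κ ≤ 1 / 256 := by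
      rw [div_le_div_iff₀ hκ0 (by norm_num)]; linarith
    have h4 := mul_le_mul_of_nonneg_right h3 (sq_nonneg (A.Llo * R))
    rw [mul_pow, hwsq]
    linarith
  have hprob := AdaptiveSGD.ofReal_one_sub_le_measure_track (m := m) (xstar := xstar) (R := R)
    (w := w) (t := A.Lhi * A.ε) (δ := A.α) hd.continuous hgrad hG hσ hξ hmap hind hR hlo hmem hρ0
    hbatch (Real.sqrt_nonneg _) (by positivity) (by omega) ?_
  · refine hprob.trans (measure_mono fun ω hω => ?_)
    refine AdaptiveSGD.output_gap_le (m := m) hconv hlip hmin hR hR0 hlo hLhi hmem ?_ hε hN hw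
      hω.1 hω.2
    rw [← Real.rpow_natCast, ← hm, Real.rpow_logb two_pos (by norm_num) (by positivity),
      div_mul_cancel₀ _ hlo.ne']
  · have h1 : -(w ^ 2 * ρ / (4 * A.N * σ ^ 2)) = -(4 * A.logFactor) := by
      rw [hwsq]; field_simp; norm_num
    have h2 : 4 * A.logFactor ≤ ρ * (A.Lhi * A.ε) / (16 * σ ^ 2) := by
      rw [le_div_iff₀ (by positivity)]
      have e1 : ρ * (A.Lhi * A.ε) = κ * A.σ₀ ^ 2 * A.logFactor * (A.Lhi / A.Llo) ^ 2 := by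
        rw [hρ]; field_simp
      have e2 : 1 ≤ (A.Lhi / A.Llo) ^ 2 := one_le_pow₀ ((one_le_div hlo).2 hlohi)
      have e3 : 64 * σ ^ 2 * A.logFactor ≤ κ * A.σ₀ ^ 2 * A.logFactor := by
        gcongr
        linarith
      rw [e1]
      have e4 := mul_le_mul_of_nonneg_left e2 (by positivity : 0 ≤ κ * A.σ₀ ^ 2 * A.logFactor)
      linarith
    rw [h1]
    exact union_bound_le hNr hα1 hexpΛ h2
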